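/- Let $\mathcal A$ be a von Neumann algebra with a finite, normal, faithful trace $\tau$, let $\mathcal A_h$ be the real vector space of selfadjoint elements of $\mathcal A$, and let $\Sigma=e^{\mathcal A_h}$ be the set of positive invertible elements of $\mathcal A$. For $a\in\Sigma$ and $x,y\in\mathcal A_h$ put $\langle x,y\rangle_a=\tau(xa^{-1}ya^{-1})$, and for $a,b\in\Sigma$ let $$\mathrm{dist}(a,b)=\inf_\gamma \int_0^1\langle\dot\gamma(t),\dot\gamma(t)\rangle_{\gamma(t)}^{1/2}\,dt ,$$ where $\gamma:[0,1]\to\Sigma$ runs over the curves with $\gamma(0)=a$, $\gamma(1)=b$ that are continuously differentiable for the operator norm. Let $H\subseteq\mathcal A_h$ be a norm-closed real linear subspace such that 1. there is a norm-closed real linear subspace $S\subseteq\mathcal A_h$ with $\mathcal A_h=H\oplus S$ and $\tau(xs)=0$ for all $x\in H$, $s\in S$; 2. $[x,[x,y]]\in H$ for all $x,y\in H$, where $[x,y]=xy-yx$. Put $M=e^H=\{e^x:x\in H\}$. Then for every $z\in\mathcal A_h$ there is exactly one pair $(y,w)$ with $y\in H$, $w\in\mathcal A_h$, $\tau(wx)=0$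 for all $x\in H$, and $$e^z=e^y\,e^w\,e^y .$$ Moreover, $e^{2y}$ is the unique point of $M$ that minimizes the distance to $e^z$: one has $\mathrm{dist}(e^z,e^{2y})\le \mathrm{dist}(e^z,q)$ for all $q\in M$, and $e^{2y}$ is the only point of $M$ with this property. -/

import Mathlib

open scoped ComplexOrder InnerProductSpace
open Set

noncomputable section

/-- A von Neumann algebra is norm closed, being a commutant; hence it is a C⋆-algebra. -/
instance VonNeumannAlgebra.isClosed_toStarSubalgebra {K : Type*} [NormedAddCommGroup K]
    [InnerProductSpace ℂ K] [CompleteSpace K] (A : VonNeumannAlgebra K) :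
    IsClosed (A.toStarSubalgebra : Set (K →L[ℂ] K)) := by
  have h := A.centralizer_centralizer'
  change IsClosed A.carrier
  rw [← h]
  exact Set.isClosed_centralizer _

namespace FiniteVN

/-- `τ` is a finite, normal and faithful trace on the von Neumann algebra `A`.
(Multiply by a positive constant to get a tracial state.) Normality is continuity for the
ultraweak topology of `A`, whose continuous functionals are those in the field `normal`. -/
structure IsFiniteTrace {K : Type*} [NormedAddCommGroup K] [InnerProductSpace ℂ K]
    [CompleteSpace K] (A : VonNeumannAlgebra K) (τ : A.toStarSubalgebra →ₗ[ℂ] ℂ) : Prop where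
  nonneg : ∀ x, 0 ≤ τ (star x * x)
  tracial : ∀ x y, τ (x * y) = τ (y * x)
  faithful : ∀ x, τ (star x * x) = 0 → x = 0
  normal : ∃ ξ η : ℕ → K, Summable (fun n => ‖ξ n‖ ^ 2) ∧ Summable (fun n => ‖η n‖ ^ 2) ∧
    ∀ x : A.toStarSubalgebra, HasSum (fun n => ⟪η n, (x : K →L[ℂ] K) (ξ n)⟫_ℂ) (τ x)

variable {𝒜 : Type*} [CStarAlgebra 𝒜]

/-- `Σ = exp(𝒜_h)`, the positive invertible elements. -/
def posCone (𝒜 : Type*) [CStarAlgebra 𝒜] : Set 𝒜 :=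
  NormedSpace.exp '' {x : 𝒜 | IsSelfAdjoint x}

/-- The metric `⟨x, y⟩_a = τ(x a⁻¹ y a⁻¹)` at `a ∈ Σ`; it is real for self-adjoint `x`, `y`. -/
def metricInner (τ : 𝒜 →ₗ[ℂ] ℂ) (a x y : 𝒜) : ℝ :=
  (τ (x * Ring.inverse a * y * Ring.inverse a)).re

/-- The length `∫₀¹ ⟨γ', γ'⟩_γ^{1/2} dt` of a curve `γ : [0, 1] → Σ`. -/
def curveLength (τ : 𝒜 →ₗ[ℂ] ℂ) (γ : ℝ → 𝒜) : ℝ :=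
  ∫ t in (0 : ℝ)..1, Real.sqrt (metricInner τ (γ t)
    (derivWithin γ (Icc 0 1) t) (derivWithin γ (Icc 0 1) t))

/-- The curve `γ : [0, 1] → Σ` joins `a` to `b` and is `C¹` for the norm topology. -/
structure IsCurveJoining (a b : 𝒜) (γ : ℝ → 𝒜) : Prop where
  contDiffOn : ContDiffOn ℝ 1 γ (Icc 0 1)
  mem_posCone : ∀ t ∈ Icc (0 : ℝ) 1, γ t ∈ posCone 𝒜
  source : γ 0 = a
  target : γ 1 = b

/-- The geodesic distance of `Σ`: the infimum of the lengths of curves in `Σ`. -/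
def geodesicDist (τ : 𝒜 →ₗ[ℂ] ℂ) (a b : 𝒜) : ℝ :=
  sInf (curveLength τ '' {γ | IsCurveJoining a b γ})

/-- `𝒜_h = H ⊕ S` for a closed subspace `S` which is `τ`-orthogonal to `H`. -/
def HasOrthogonalSupplement (τ : 𝒜 →ₗ[ℂ] ℂ) (H : Submodule ℝ 𝒜) : Prop :=
  ∃ S : Submodule ℝ 𝒜, IsClosed (S : Set 𝒜) ∧ (∀ x ∈ H, ∀ s ∈ S, τ (x * s) = 0) ∧
    Disjoint H S ∧ H ⊔ S = selfAdjoint.submodule ℝ 𝒜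

/-- `e^z = e^y e^w e^y` with `y ∈ H` and `w ∈ 𝒜_h` orthogonal to `H`. -/
structure IsFactorization (τ : 𝒜 →ₗ[ℂ] ℂ) (H : Submodule ℝ 𝒜) (z y w : 𝒜) : Prop where
  mem : y ∈ H
  selfAdjoint : IsSelfAdjoint w
  orthogonal : ∀ x ∈ H, τ (w * x) = 0
  exp_eq : NormedSpace.exp z = NormedSpace.exp y * NormedSpace.exp w * NormedSpace.exp y

/-- `p` is a point of `M` at minimal geodesic distance from `r`. -/
def IsNearestPoint (τ : 𝒜 →ₗ[ℂ] ℂ) (M : Set 𝒜) (r p : 𝒜) : Prop :=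
  p ∈ M ∧ ∀ q ∈ M, geodesicDist τ r p ≤ geodesicDist τ r q

end FiniteVN

end

/-! Write `‖x‖₂` for `nrm τ x`. Congruences `a ↦ e^y a e^y` are isometries of the geodesic distance
(`geodesicDist_congr`), and `dist(e^w, 1) = ‖w‖₂` (`geodesicDist_exp_one`). So if `e^z = e^y e^w
e^y`, then `dist(e^z, e^{2y}) = ‖w‖₂`. The geometric input is nonpositive curvature in the form `‖a
- b‖₂ ≤ dist(e^a, e^b)` (`nrm_sub_le_geodesicDist`). It holds because the derivative of `exp` at
`X`, translated to the identity, is a limit of products of operators `cosh (ad X/2^k)`, each of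
which expands `‖·‖₂` on selfadjoint elements.

The algebraic input is that `e^y M e^y ⊆ M` for `y ∈ H` (`exp_congr_mem`): the curve `log (e^{ty}
e^x e^{ty})` follows a locally Lipschitz vector field that maps `H` to itself.

Uniqueness and minimality are then Pythagoras. A point of `M` has the form `e^y e^x e^y` with `x ∈
H`, and its squared distance to `e^z` is at least `‖w - x‖₂² = ‖w‖₂² + ‖x‖₂²` when `w ⊥ H`
(`nearest_of_isFactorization`).

For existence, minimize `‖w(y)‖₂²` over an operator-norm ball of `H`, where `e^z = e^y e^{w(y)}
e^y`. With `P` the projection onto `H`, moving in the direction `P w(y)` lowers the value, and a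
small step does not leave the ball. The latter rests on the bound `‖w(y) + 2y‖ ≤ ‖z‖` from operator
monotonicity of the logarithm, which makes `P w(y)` a bounded vector minus `2y`, hence inward
pointing (`exists_descent`). Therefore near-minimizers are nearly critical, nonpositive curvature
makes a minimizing sequence Cauchy for `‖·‖₂` (`nrm_sub_le_of_almost_minimal`), and normality of the
trace makes balls complete (`exists_limit`). At the limit no descent is possible, so `P w = 0`, that
is, `w ⊥ H`. -/

namespace FiniteVN

open NormedSpace Filter Topology

/-! ### Exponential, logarithm and operator order on the positive cone -/

section ExpLog

variable {𝒜 : Type*} [CStarAlgebra 𝒜]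

lemma exp_add_of_commute {x y : 𝒜} (h : Commute x y) : exp (x + y) = exp x * exp y :=
  let := NormedAlgebra.restrictScalars ℚ ℂ 𝒜
  NormedSpace.exp_add_of_commute h

lemma isUnit_exp (x : 𝒜) : IsUnit (exp x) :=
  let := NormedAlgebra.restrictScalars ℚ ℂ 𝒜
  NormedSpace.isUnit_exp x

lemma continuous_exp : Continuous (exp : 𝒜 → 𝒜) :=
  let := NormedAlgebra.restrictScalars ℚ ℂ 𝒜
  NormedSpace.exp_continuous

lemma exp_neg_mul_exp (x : 𝒜) : exp (-x) * exp x = 1 := by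
  rw [← exp_add_of_commute (Commute.refl x).neg_left, neg_add_cancel, exp_zero]

lemma exp_mul_exp_neg (x : 𝒜) : exp x * exp (-x) = 1 := by
  rw [← exp_add_of_commute (Commute.refl x).neg_right, add_neg_cancel, exp_zero]

lemma exp_neg_mul_exp_mul (x a : 𝒜) : exp (-x) * (exp x * a) = a := by
  rw [← mul_assoc, exp_neg_mul_exp, one_mul]

lemma exp_mul_exp_neg_mul (x a : 𝒜) : exp x * (exp (-x) * a) = a := by
  rw [← mul_assoc, exp_mul_exp_neg, one_mul]

lemma exp_smul_add (s t : ℝ) (x : 𝒜) : exp ((s + t) • x) = exp (s • x) * exp (t • x) := by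
  rw [add_smul, exp_add_of_commute (((Commute.refl x).smul_left s).smul_right t)]

lemma exp_eq_half_mul_half (x : 𝒜) :
    exp x = exp ((1 / 2 : ℝ) • x) * exp ((1 / 2 : ℝ) • x) := by
  rw [← exp_smul_add]; norm_num

lemma exp_two_smul (x : 𝒜) : exp ((2 : ℝ) • x) = exp x * exp x := by
  rw [exp_eq_half_mul_half, smul_smul]; norm_num

lemma isSelfAdjoint_smul {x : 𝒜} (hx : IsSelfAdjoint x) (s : ℝ) : IsSelfAdjoint (s • x) :=
  (IsSelfAdjoint.all s).smul hx

lemma exp_mem_posCone {x : 𝒜} (hx : IsSelfAdjoint x) : exp x ∈ posCone 𝒜 :=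
  ⟨x, hx, rfl⟩

lemma exp_log_of_mem_posCone {a : 𝒜} (ha : a ∈ posCone 𝒜) : exp (CFC.log a) = a := by
  obtain ⟨x, hx, rfl⟩ := ha
  rw [CFC.log_exp x hx]

lemma exp_injOn {x y : 𝒜} (hx : IsSelfAdjoint x) (hy : IsSelfAdjoint y) (h : exp x = exp y) :
    x = y := by
  rw [← CFC.log_exp x hx, h, CFC.log_exp y hy]

lemma isSelfAdjoint_of_mem_posCone {a : 𝒜} (ha : a ∈ posCone 𝒜) : IsSelfAdjoint a := by
  obtain ⟨x, hx, rfl⟩ := ha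
  exact IsSelfAdjoint.exp hx

lemma isUnit_of_mem_posCone {a : 𝒜} (ha : a ∈ posCone 𝒜) : IsUnit a := by
  obtain ⟨x, hx, rfl⟩ := ha
  exact isUnit_exp x

lemma continuousOn_log_posCone : ContinuousOn CFC.log (posCone 𝒜) :=
  CFC.continuousOn_log.mono fun _ ha =>
    ⟨isSelfAdjoint_of_mem_posCone ha, isUnit_of_mem_posCone ha⟩

lemma exp_algebraMap (r : ℝ) : exp (algebraMap ℝ 𝒜 r) = algebraMap ℝ 𝒜 (Real.exp r) := by
  rw [Real.exp_eq_exp_ℝ, algebraMap_exp_comm]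

lemma exp_smul_one (r : ℝ) : exp (r • (1 : 𝒜)) = Real.exp r • 1 := by
  rw [← Algebra.algebraMap_eq_smul_one, exp_algebraMap, Algebra.algebraMap_eq_smul_one]

lemma exp_add_smul_one (x : 𝒜) (r : ℝ) : exp (x + r • 1) = Real.exp r • exp x := by
  rw [exp_add_of_commute ((Commute.one_right x).smul_right r), exp_smul_one, mul_smul_comm, mul_one]

section Order

variable [PartialOrder 𝒜] [StarOrderedRing 𝒜]

lemma exp_pos_of_isSelfAdjoint {x : 𝒜} (hx : IsSelfAdjoint x) : IsStrictlyPositive (exp x) :=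
  IsStrictlyPositive.iff_of_unital.mpr ⟨hx.exp_nonneg, isUnit_exp x⟩

lemma mem_posCone_iff {a : 𝒜} : a ∈ posCone 𝒜 ↔ IsStrictlyPositive a := by
  refine ⟨?_, fun ha => ⟨CFC.log a, IsSelfAdjoint.log, CFC.exp_log a ha⟩⟩
  rintro ⟨x, hx, rfl⟩
  exact exp_pos_of_isSelfAdjoint hx

lemma le_of_exp_le_exp {x y : 𝒜} (hx : IsSelfAdjoint x) (hy : IsSelfAdjoint y)
    (h : exp x ≤ exp y) : x ≤ y := by
  have := CFC.log_le_log h (exp_pos_of_isSelfAdjoint hx)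
  rwa [CFC.log_exp x hx, CFC.log_exp y hy] at this

lemma le_norm_smul_one {x : 𝒜} (hx : IsSelfAdjoint x) : x ≤ ‖x‖ • 1 := by
  simpa [Algebra.algebraMap_eq_smul_one] using hx.le_algebraMap_norm_self

lemma neg_norm_smul_one_le {x : 𝒜} (hx : IsSelfAdjoint x) : (-‖x‖) • 1 ≤ x := by
  simpa [Algebra.algebraMap_eq_smul_one] using hx.neg_algebraMap_norm_le_self

lemma norm_le_of_smul_one_le {x : 𝒜} (hx : IsSelfAdjoint x) {r : ℝ} (hr : 0 ≤ r)
    (h₁ : x ≤ r • 1) (h₂ : (-r) • 1 ≤ x) : ‖x‖ ≤ r := by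
  rcases subsingleton_or_nontrivial 𝒜 with h | h
  · rwa [Subsingleton.elim x 0, norm_zero]
  rw [← Algebra.algebraMap_eq_smul_one] at h₁ h₂
  have h₁' := (le_algebraMap_iff_spectrum_le (a := x) hx).1 h₁
  have h₂' := (algebraMap_le_iff_le_spectrum (a := x) hx).1 h₂
  rcases CStarAlgebra.norm_or_neg_norm_mem_spectrum hx with hk | hk
  · exact h₁' _ hk
  · linarith [h₂' _ hk]

end Order

/-- The operator monotonicity of the logarithm bounds the logarithm of a congruence. -/
lemma norm_log_congr_add_le {w y z : 𝒜} (hw : IsSelfAdjoint w) (hy : IsSelfAdjoint y)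
    (hz : IsSelfAdjoint z) (h : exp w = exp (-y) * exp z * exp (-y)) :
    ‖w + (2 : ℝ) • y‖ ≤ ‖z‖ := by
  let := CStarAlgebra.spectralOrder 𝒜
  have := CStarAlgebra.spectralOrderedRing 𝒜
  have hy2 := isSelfAdjoint_smul hy 2
  have key : ∀ r : ℝ, exp (-((2 : ℝ) • y) + r • 1) = exp (-y) * exp (r • (1 : 𝒜)) * exp (-y) := by
    intro r
    rw [exp_add_smul_one, exp_smul_one, ← smul_neg, exp_two_smul]
    simp
  have hsa : ∀ r : ℝ, IsSelfAdjoint (-((2 : ℝ) • y) + r • (1 : 𝒜)) := fun r =>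
    hy2.neg.add (isSelfAdjoint_smul (IsSelfAdjoint.one 𝒜) r)
  have hmono : ∀ {a b : 𝒜}, a ≤ b → exp (-y) * a * exp (-y) ≤ exp (-y) * b * exp (-y) :=
    fun hab => (IsSelfAdjoint.exp hy.neg).conjugate_le_conjugate hab
  -- The exponential is not operator monotone, but here one of the two elements is always a scalar,
  -- so the commuting case is enough.
  have hexp : ∀ {a b : 𝒜}, IsSelfAdjoint a → IsSelfAdjoint b → Commute a b → a ≤ b → exp a ≤ exp b := by
    intro a b ha hb hc hab
    have h1 : 0 ≤ b - a := sub_nonneg.2 hab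
    have h3 : (1 : 𝒜) ≤ exp (b - a) := by
      rw [← CFC.real_exp_eq_normedSpace_exp (hb.sub ha)]
      rw [one_le_cfc_iff (R := ℝ) Real.exp (b - a)]
      intro t ht
      exact Real.one_le_exp (spectrum_nonneg_of_nonneg h1 ht)
    have h4 : exp b = exp ((1 / 2 : ℝ) • a) * exp (b - a) * exp ((1 / 2 : ℝ) • a) := by
      have hc' : Commute ((1 / 2 : ℝ) • a) (b - a) :=
        (hc.sub_right (Commute.refl a)).smul_left _
      rw [(hc'.exp).eq, mul_assoc, ← exp_eq_half_mul_half,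
        ← exp_add_of_commute (hc.symm.sub_left (Commute.refl a)), sub_add_cancel]
    rw [h4, exp_eq_half_mul_half a]
    simpa using (IsSelfAdjoint.exp (isSelfAdjoint_smul ha (1 / 2))).conjugate_le_conjugate h3
  have hone : ∀ r : ℝ, IsSelfAdjoint (r • (1 : 𝒜)) :=
    fun r => isSelfAdjoint_smul (IsSelfAdjoint.one 𝒜) r
  have up : w ≤ -((2 : ℝ) • y) + ‖z‖ • 1 := by
    apply le_of_exp_le_exp hw (hsa _)
    rw [key, h]
    exact hmono (hexp hz (hone _) ((Commute.one_right z).smul_right _) (le_norm_smul_one hz))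
  have low : -((2 : ℝ) • y) + (-‖z‖) • 1 ≤ w := by
    apply le_of_exp_le_exp (hsa _) hw
    rw [key, h]
    exact hmono (hexp (hone _) hz ((Commute.one_left z).smul_left _) (neg_norm_smul_one_le hz))
  refine norm_le_of_smul_one_le (hw.add hy2) (norm_nonneg _) ?_ ?_
  · have := add_le_add_left up ((2 : ℝ) • y)
    simpa [add_comm, add_assoc] using this
  · have := add_le_add_left low ((2 : ℝ) • y)
    simpa [add_comm, add_assoc] using this

lemma congr_mem_posCone {g a : 𝒜} (hg : IsUnit g) (ha : a ∈ posCone 𝒜) :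
    star g * a * g ∈ posCone 𝒜 := by
  let := CStarAlgebra.spectralOrder 𝒜
  have := CStarAlgebra.spectralOrderedRing 𝒜
  rw [mem_posCone_iff, IsStrictlyPositive.iff_of_unital] at *
  exact ⟨star_left_conjugate_nonneg ha.1 g, (hg.star.mul ha.2).mul hg⟩

lemma exp_congr_mem_posCone {y a : 𝒜} (hy : IsSelfAdjoint y) (ha : a ∈ posCone 𝒜) :
    exp y * a * exp y ∈ posCone 𝒜 := by
  simpa [(IsSelfAdjoint.exp hy).star_eq] using congr_mem_posCone (isUnit_exp y) ha

lemma segment_mem_posCone {a b : 𝒜} (ha : a ∈ posCone 𝒜) (hb : b ∈ posCone 𝒜) {s : ℝ}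
    (hs : s ∈ Icc (0 : ℝ) 1) : (1 - s) • a + s • b ∈ posCone 𝒜 := by
  let := CStarAlgebra.spectralOrder 𝒜
  have := CStarAlgebra.spectralOrderedRing 𝒜
  rcases hs.1.eq_or_lt with rfl | h0
  · simpa
  rw [mem_posCone_iff] at *
  rw [add_comm]
  exact (hb.smul h0).add_nonneg (smul_nonneg (by linarith [hs.2]) ha.nonneg)

/-- Put `v = s(b - 2y)` and `X = 2ρ - 2y ≥ 0`. For small `s`, `e^v ≤ 1 + v + v²` with `v² ≤ s`, and
the slack in `b ≤ 2ρ - 1` absorbs this quadratic error: `e^v ≤ 1 + sX ≤ 1 + X ≤ e^X`. Conjugating by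
`e^y` cancels the `-2y` in `X`. -/
lemma mul_exp_le_of_small [PartialOrder 𝒜] [StarOrderedRing 𝒜] {ρ s : ℝ} {y b : 𝒜}
    (hy : IsSelfAdjoint y) (hb : IsSelfAdjoint b)
    (hyρ : ‖y‖ ≤ ρ) (hbρ : ‖b‖ ≤ 2 * ρ - 1) (hs0 : 0 ≤ s) (hs1 : s * (4 * ρ + 1) ^ 2 ≤ 1)
    (hρ : 0 ≤ ρ) :
    exp y * exp (s • (b - (2 : ℝ) • y)) * exp y ≤ exp ((2 * ρ) • (1 : 𝒜)) := by
  have h1ρ : 0 ≤ 2 * ρ - 1 := (norm_nonneg _).trans hbρ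
  have hs2 : s ≤ 1 := by nlinarith [mul_nonneg hs0 hρ, mul_nonneg hs0 (mul_nonneg hρ hρ)]
  set v : 𝒜 := s • (b - (2 : ℝ) • y) with hv
  have hvsa : IsSelfAdjoint v := isSelfAdjoint_smul (hb.sub (isSelfAdjoint_smul hy 2)) s
  have hvn : ‖v‖ ≤ s * (4 * ρ + 1) := by
    rw [hv, norm_smul, Real.norm_of_nonneg hs0]
    refine mul_le_mul_of_nonneg_left ((norm_sub_le _ _).trans ?_) hs0
    rw [norm_smul]; norm_num; linarith
  have hv1 : ‖v‖ ≤ 1 := by nlinarith [mul_nonneg hs0 hρ]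
  have hvsq : v * v ≤ s • 1 := by
    have h := le_norm_smul_one (show IsSelfAdjoint (v * v) by simpa [sq] using hvsa.pow 2)
    refine h.trans (smul_le_smul_of_nonneg_right ?_ zero_le_one)
    calc ‖v * v‖ ≤ ‖v‖ * ‖v‖ := norm_mul_le _ _
      _ ≤ (s * (4 * ρ + 1)) * (s * (4 * ρ + 1)) := by gcongr
      _ = s * (s * (4 * ρ + 1) ^ 2) := by ring
      _ ≤ s := by nlinarith
  rcases subsingleton_or_nontrivial 𝒜 with hsub | hsub
  · exact (Subsingleton.elim _ _).le
  have hev : exp v ≤ 1 + v + v * v := by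
    have h : cfc Real.exp v ≤ cfc (fun t : ℝ => 1 + t + t * t) v := by
      refine cfc_mono fun t ht => ?_
      have ht' : |t| ≤ 1 := (spectrum.norm_le_norm_of_mem ht).trans hv1
      have := Real.abs_exp_sub_one_sub_id_le ht'
      nlinarith [(abs_le.1 this).2]
    rw [CFC.real_exp_eq_normedSpace_exp hvsa] at h
    refine h.trans_eq ?_
    rw [cfc_add .., cfc_add .., cfc_mul .., cfc_id' ℝ v, cfc_const_one ℝ v]
  have hble : b ≤ (2 * ρ - 1) • 1 :=
    (le_norm_smul_one hb).trans (smul_le_smul_of_nonneg_right hbρ zero_le_one)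
  have hyle : y ≤ ρ • 1 :=
    (le_norm_smul_one hy).trans (smul_le_smul_of_nonneg_right hyρ zero_le_one)
  set X : 𝒜 := (2 * ρ) • 1 - (2 : ℝ) • y with hX
  have hX0 : 0 ≤ X := by
    have h := smul_le_smul_of_nonneg_left hyle (show (0 : ℝ) ≤ 2 by norm_num)
    rw [smul_smul] at h
    exact sub_nonneg.2 h
  have hXsa : IsSelfAdjoint X := IsSelfAdjoint.of_nonneg hX0
  have h2 : exp v ≤ 1 + X := by
    calc exp v ≤ 1 + v + s • 1 := hev.trans (by gcongr)
      _ ≤ 1 + s • ((2 * ρ - 1) • 1 - (2 : ℝ) • y) + s • 1 := by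
        rw [hv]; gcongr
      _ = 1 + s • X := by rw [hX]; module
      _ ≤ 1 + (1 : ℝ) • X := by gcongr
      _ = 1 + X := by rw [one_smul]
  have h3 : 1 + X ≤ exp X := by
    have h : cfc (fun t : ℝ => 1 + t) X ≤ cfc Real.exp X := by
      refine cfc_mono fun t _ => ?_
      linarith [Real.add_one_le_exp t]
    rw [CFC.real_exp_eq_normedSpace_exp hXsa] at h
    refine le_trans (le_of_eq ?_) h
    rw [cfc_add .., cfc_id' ℝ X, cfc_const_one ℝ X]
  have h4 := (IsSelfAdjoint.exp hy).conjugate_le_conjugate (h2.trans h3)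
  refine h4.trans_eq ?_
  rw [hX, sub_eq_neg_add, exp_add_smul_one, exp_smul_one, ← smul_neg, exp_two_smul]
  simp [exp_mul_exp_neg_mul, exp_neg_mul_exp]

/-- A gradient-like step from a point of the ball of radius `ρ` stays in that ball. -/
lemma norm_log_step_le {ρ s : ℝ} {y b v : 𝒜}
    (hy : IsSelfAdjoint y) (hb : IsSelfAdjoint b) (hv : IsSelfAdjoint v)
    (hyρ : ‖y‖ ≤ ρ) (hbρ : ‖b‖ ≤ 2 * ρ - 1) (hs0 : 0 ≤ s) (hs1 : s * (4 * ρ + 1) ^ 2 ≤ 1)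
    (h : exp ((2 : ℝ) • v) = exp y * exp (s • (b - (2 : ℝ) • y)) * exp y) :
    ‖v‖ ≤ ρ := by
  let := CStarAlgebra.spectralOrder 𝒜
  have := CStarAlgebra.spectralOrderedRing 𝒜
  have hρ : 0 ≤ ρ := (norm_nonneg _).trans hyρ
  have h1 := mul_exp_le_of_small hy hb hyρ hbρ hs0 hs1 hρ
  have h2 := mul_exp_le_of_small hy.neg hb.neg (by rwa [norm_neg]) (by rwa [norm_neg]) hs0 hs1 hρ
  have hsa := isSelfAdjoint_smul (IsSelfAdjoint.one 𝒜) (2 * ρ)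
  have hv2 := isSelfAdjoint_smul hv 2
  -- The lower bound on `v` is the upper bound for the inverse, which has the same shape with `y`
  -- and `b` negated.
  have h' : exp (-((2 : ℝ) • v)) =
      exp (-y) * exp (s • (-b - (2 : ℝ) • -y)) * exp (-y) := by
    have e : s • (-b - (2 : ℝ) • -y) = -(s • (b - (2 : ℝ) • y)) := by module
    rw [e]
    refine left_inv_eq_right_inv (exp_neg_mul_exp _) ?_
    rw [h]
    simp only [mul_assoc, exp_mul_exp_neg_mul, exp_mul_exp_neg]
  rw [← h] at h1
  rw [← h'] at h2
  have h1' := le_of_exp_le_exp hv2 hsa h1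
  have h2' := le_of_exp_le_exp hv2.neg hsa h2
  have h3 : ‖(2 : ℝ) • v‖ ≤ 2 * ρ := by
    refine norm_le_of_smul_one_le hv2 (by linarith) h1' ?_
    rw [neg_smul]
    exact neg_le.1 h2'
  rw [norm_smul] at h3
  norm_num at h3
  linarith

end ExpLog
end FiniteVN

namespace FiniteVN

open NormedSpace Filter Topology

/-! ### The trace norm and its inequalities -/

section Trace

universe u

variable {𝒜 : Type u} [CStarAlgebra 𝒜] {τ : 𝒜 →ₗ[ℂ] ℂ}

/-- A faithful positive tracial functional on a C⋆-algebra. -/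
structure IsFaithfulTrace (τ : 𝒜 →ₗ[ℂ] ℂ) : Prop where
  nonneg : ∀ x, 0 ≤ τ (star x * x)
  tracial : ∀ x y, τ (x * y) = τ (y * x)
  faithful : ∀ x, τ (star x * x) = 0 → x = 0

/-- The norm `‖x‖₂ = τ(x⋆x)^{1/2}`. -/
noncomputable def nrm (τ : 𝒜 →ₗ[ℂ] ℂ) (x : 𝒜) : ℝ := √(τ (star x * x)).re

/-- The real bilinear form `Re τ(xy)`. -/
noncomputable def ip (τ : 𝒜 →ₗ[ℂ] ℂ) (x y : 𝒜) : ℝ := (τ (x * y)).re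

lemma nrm_nonneg (x : 𝒜) : 0 ≤ nrm τ x := Real.sqrt_nonneg _

lemma nrm_neg (x : 𝒜) : nrm τ (-x) = nrm τ x := by
  simp [nrm]

lemma nrm_sub_comm (x y : 𝒜) : nrm τ (x - y) = nrm τ (y - x) := by
  rw [← neg_sub, nrm_neg]

lemma norm_exp_le (x : 𝒜) : ‖exp x‖ ≤ Real.exp ‖x‖ := by
  rcases subsingleton_or_nontrivial 𝒜 with h | h
  · rw [Subsingleton.elim (exp x) 0, norm_zero]; positivity
  have h1 := exp_series_hasSum_exp' (𝕂 := ℝ) x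
  have h2 := exp_series_hasSum_exp' (𝕂 := ℝ) ‖x‖
  rw [← Real.exp_eq_exp_ℝ] at h2
  refine h1.norm_le_of_bounded h2 fun n => ?_
  rw [norm_smul, smul_eq_mul, Real.norm_of_nonneg (by positivity)]
  gcongr
  exact norm_pow_le _ _

lemma norm_exp_smul_le (x : 𝒜) {s : ℝ} (hs : s ∈ Icc (0 : ℝ) 1) : ‖exp (s • x)‖ ≤ Real.exp ‖x‖ := by
  refine (norm_exp_le _).trans (Real.exp_le_exp.2 ?_)
  rw [norm_smul, Real.norm_of_nonneg hs.1]
  exact mul_le_of_le_one_left (norm_nonneg _) hs.2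

lemma hasDerivAt_exp_smul (x : 𝒜) (t : ℝ) :
    HasDerivAt (fun s : ℝ => exp (s • x)) (exp (t • x) * x) t :=
  hasDerivAt_exp_smul_const x t

lemma hasDerivAt_exp_one_sub_smul (x : 𝒜) (t : ℝ) :
    HasDerivAt (fun s : ℝ => exp ((1 - s) • x)) (-(x * exp ((1 - t) • x))) t := by
  have h := (hasDerivAt_exp_smul_const' x (1 - t)).scomp t ((hasDerivAt_id t).const_sub 1)
  simpa [Function.comp_def] using h

/-- The Gelfand–Naimark–Segal Hilbert space of a positive functional. -/
lemma exists_gns (hτ : IsFaithfulTrace τ) :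
    ∃ (E : Type u) (_ : NormedAddCommGroup E) (_ : InnerProductSpace ℂ E) (Λ : 𝒜 →L[ℂ] E),
      (∀ x y, ⟪Λ x, Λ y⟫_ℂ = τ (star x * y)) ∧ ∀ a x, ‖Λ (a * x)‖ ≤ ‖a‖ * ‖Λ x‖ := by
  let := CStarAlgebra.spectralOrder 𝒜
  have := CStarAlgebra.spectralOrderedRing 𝒜
  let f : 𝒜 →ₚ[ℂ] ℂ := PositiveLinearMap.mk₀ τ fun x hx => by
    obtain ⟨y, rfl⟩ := CStarAlgebra.nonneg_iff_eq_star_mul_self.1 hx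
    exact hτ.nonneg y
  have hf : ∀ x, f x = τ x := fun _ => rfl
  obtain ⟨C, hC⟩ := f.exists_norm_apply_le
  let Λ₀ : 𝒜 →ₗ[ℂ] f.PreGNS := f.toPreGNS.toLinearMap
  have hΛ₀ : ∀ x, ‖Λ₀ x‖ ^ 2 = (τ (star x * x)).re := fun x => by
    have h := f.preGNS_norm_sq (Λ₀ x)
    have h2 : f (star (f.ofPreGNS (Λ₀ x)) * f.ofPreGNS (Λ₀ x)) = τ (star x * x) := rfl
    rw [h2] at h
    rw [← h, ← Complex.ofReal_pow, Complex.ofReal_re]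
  have hb : ∀ x, ‖Λ₀ x‖ ≤ √C * ‖x‖ := fun x => by
    rw [← sq_le_sq₀ (norm_nonneg _) (by positivity), hΛ₀, mul_pow, Real.sq_sqrt (by positivity)]
    calc (τ (star x * x)).re ≤ ‖τ (star x * x)‖ := Complex.re_le_norm _
      _ ≤ C * ‖star x * x‖ := hC _
      _ = C * ‖x‖ ^ 2 := by rw [CStarRing.norm_star_mul_self, sq]
  let Λ : 𝒜 →L[ℂ] f.GNS := UniformSpace.Completion.toComplL ∘L Λ₀.mkContinuous _ hb
  have hΛ : ∀ x, Λ x = ((Λ₀ x : f.PreGNS) : f.GNS) := fun _ => rfl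
  refine ⟨f.GNS, inferInstance, inferInstance, Λ, fun x y => ?_, fun a x => ?_⟩
  · rw [hΛ, hΛ, UniformSpace.Completion.inner_coe]
    rfl
  · rw [hΛ, hΛ, UniformSpace.Completion.norm_coe, UniformSpace.Completion.norm_coe]
    exact (f.leftMulMapPreGNS a).le_of_opNorm_le
      (LinearMap.mkContinuous_norm_le _ (norm_nonneg _) _) (Λ₀ x)

namespace IsFaithfulTrace

variable (hτ : IsFaithfulTrace τ)
include hτ

lemma exists_hilbert : ∃ (E : Type u) (_ : NormedAddCommGroup E) (_ : InnerProductSpace ℂ E)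
    (Λ : 𝒜 →L[ℂ] E), (∀ x y, ⟪Λ x, Λ y⟫_ℂ = τ (star x * y)) ∧ (∀ x, ‖Λ x‖ = nrm τ x) ∧
      ∀ a x, nrm τ (a * x) ≤ ‖a‖ * nrm τ x := by
  obtain ⟨E, i1, i2, Λ, h1, h2⟩ := exists_gns hτ
  have h3 : ∀ x, ‖Λ x‖ = nrm τ x := fun x => by
    rw [nrm, ← h1, norm_eq_sqrt_re_inner (𝕜 := ℂ)]
    rfl
  exact ⟨E, i1, i2, Λ, h1, h3, fun a x => by rw [← h3, ← h3]; exact h2 a x⟩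

lemma continuous : Continuous τ := by
  obtain ⟨E, _, _, Λ, h1, -⟩ := hτ.exists_hilbert
  have : (τ : 𝒜 → ℂ) = fun x => ⟪Λ 1, Λ x⟫_ℂ := by ext x; simp [h1]
  rw [this]
  fun_prop

lemma nrm_sq (x : 𝒜) : nrm τ x ^ 2 = ip τ (star x) x :=
  Real.sq_sqrt (Complex.nonneg_iff.1 (hτ.nonneg x)).1

lemma nrm_sq_of_isSelfAdjoint {x : 𝒜} (hx : IsSelfAdjoint x) : nrm τ x ^ 2 = ip τ x x := by
  rw [hτ.nrm_sq, hx.star_eq]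

lemma eq_zero_of_nrm_eq_zero {x : 𝒜} (h : nrm τ x = 0) : x = 0 := by
  refine hτ.faithful x (Complex.ext ?_ (Complex.nonneg_iff.1 (hτ.nonneg x)).2.symm)
  have := hτ.nrm_sq x
  rw [h] at this
  simpa [ip] using this.symm

lemma continuous_nrm : Continuous (nrm τ) := by
  unfold nrm
  have := hτ.continuous
  fun_prop

lemma nrm_add_le (x y : 𝒜) : nrm τ (x + y) ≤ nrm τ x + nrm τ y := by
  obtain ⟨E, _, _, Λ, -, h2, -⟩ := hτ.exists_hilbert
  rw [← h2, ← h2, ← h2, map_add]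
  exact norm_add_le _ _

lemma nrm_smul (r : ℝ) (x : 𝒜) : nrm τ (r • x) = |r| * nrm τ x := by
  obtain ⟨E, _, _, Λ, -, h2, -⟩ := hτ.exists_hilbert
  rw [← h2, ← h2, ← Complex.coe_smul, map_smul, norm_smul]
  simp

lemma nrm_star (x : 𝒜) : nrm τ (star x) = nrm τ x := by
  rw [nrm, nrm, star_star, hτ.tracial]

lemma nrm_mul_le_left (a x : 𝒜) : nrm τ (a * x) ≤ ‖a‖ * nrm τ x := by
  obtain ⟨E, _, _, Λ, -, -, h3⟩ := hτ.exists_hilbert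
  exact h3 a x

lemma nrm_mul_le_right (x a : 𝒜) : nrm τ (x * a) ≤ nrm τ x * ‖a‖ := by
  rw [← hτ.nrm_star, star_mul, mul_comm]
  simpa [hτ.nrm_star] using hτ.nrm_mul_le_left (star a) (star x)

lemma nrm_mul_mul_le (a x b : 𝒜) : nrm τ (a * x * b) ≤ ‖a‖ * nrm τ x * ‖b‖ :=
  (hτ.nrm_mul_le_right _ _).trans
    (mul_le_mul_of_nonneg_right (hτ.nrm_mul_le_left _ _) (norm_nonneg _))

lemma norm_map_mul_le (x y : 𝒜) : ‖τ (x * y)‖ ≤ nrm τ x * nrm τ y := by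
  obtain ⟨E, _, _, Λ, h1, h2, -⟩ := hτ.exists_hilbert
  have := norm_inner_le_norm (𝕜 := ℂ) (Λ (star x)) (Λ y)
  rwa [h1, h2, h2, star_star, hτ.nrm_star] at this

lemma abs_ip_le (x y : 𝒜) : |ip τ x y| ≤ nrm τ x * nrm τ y :=
  (Complex.abs_re_le_norm _).trans (hτ.norm_map_mul_le x y)

lemma ip_comm (x y : 𝒜) : ip τ x y = ip τ y x := by
  rw [ip, ip, hτ.tracial]

/-- A mean value inequality for the norm of the trace. -/
lemma nrm_sub_le_of_hasDerivAt {f f' : ℝ → 𝒜} {C : ℝ}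
    (hf : ∀ s ∈ Icc (0 : ℝ) 1, HasDerivAt f (f' s) s) (hC : ∀ s ∈ Icc (0 : ℝ) 1, nrm τ (f' s) ≤ C) :
    nrm τ (f 1 - f 0) ≤ C := by
  obtain ⟨E, _, _, Λ, -, h2, -⟩ := hτ.exists_hilbert
  let _ := NormedSpace.restrictScalars ℝ ℂ E
  rw [← h2, map_sub]
  refine norm_image_sub_le_of_norm_deriv_le_segment_01' (f := fun s => Λ (f s))
    (f' := fun s => Λ (f' s)) (fun s hs => ?_) (fun s hs => ?_)
  · exact ((Λ.restrictScalars ℝ).hasFDerivAt.comp_hasDerivAt s (hf s hs)).hasDerivWithinAt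
  · rw [h2]; exact hC s ⟨hs.1, hs.2.le⟩

/-- Duhamel: the path `e^{sa} e^{(1-s)b}` runs from `e^b` to `e^a` with derivative `e^{sa} (a - b)
e^{(1-s)b}`. -/
lemma nrm_exp_sub_exp_le (a b : 𝒜) :
    nrm τ (exp a - exp b) ≤ Real.exp ‖a‖ * nrm τ (a - b) * Real.exp ‖b‖ := by
  have h : ∀ s : ℝ, HasDerivAt (fun s : ℝ => exp (s • a) * exp ((1 - s) • b))
      (exp (s • a) * (a - b) * exp ((1 - s) • b)) s := fun s => by
    refine ((hasDerivAt_exp_smul a s).fun_mul (hasDerivAt_exp_one_sub_smul b s)).congr_deriv ?_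
    rw [mul_sub, sub_mul, mul_neg, ← sub_eq_add_neg, mul_assoc _ b]
  have := hτ.nrm_sub_le_of_hasDerivAt (fun s _ => h s)
    (C := Real.exp ‖a‖ * nrm τ (a - b) * Real.exp ‖b‖) fun s hs => by
      refine (hτ.nrm_mul_mul_le _ _ _).trans ?_
      have := nrm_nonneg (τ := τ) (a - b)
      gcongr
      · exact norm_exp_smul_le a hs
      · exact norm_exp_smul_le b ⟨by linarith [hs.2], by linarith [hs.1]⟩
  simpa using this

end IsFaithfulTrace

lemma ip_add_left (x y z : 𝒜) : ip τ (x + y) z = ip τ x z + ip τ y z := by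
  simp [ip, add_mul]

lemma ip_add_right (x y z : 𝒜) : ip τ x (y + z) = ip τ x y + ip τ x z := by
  simp [ip, mul_add]

lemma ip_sub_left (x y z : 𝒜) : ip τ (x - y) z = ip τ x z - ip τ y z := by
  simp [ip, sub_mul]

lemma ip_sub_right (x y z : 𝒜) : ip τ x (y - z) = ip τ x y - ip τ x z := by
  simp [ip, mul_sub]

lemma ip_smul_left (r : ℝ) (x y : 𝒜) : ip τ (r • x) y = r * ip τ x y := by
  rw [ip, ip, smul_mul_assoc, ← Complex.coe_smul, map_smul]
  simp

lemma ip_smul_right (r : ℝ) (x y : 𝒜) : ip τ x (r • y) = r * ip τ x y := by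
  rw [ip, ip, mul_smul_comm, ← Complex.coe_smul, map_smul]
  simp

end Trace
end FiniteVN

namespace FiniteVN

open NormedSpace Filter Topology

/-! ### Exponentials of left plus right multiplications -/

section MulExp

variable {𝕜 R : Type*} [RCLike 𝕜] [NormedRing R] [NormedAlgebra 𝕜 R] [CompleteSpace R]

variable (𝕜) in
/-- Left multiplication as a ring homomorphism into bounded operators. -/
noncomputable def lmulHom : R →+* (R →L[𝕜] R) where
  toFun a := ContinuousLinearMap.mul 𝕜 R a
  map_one' := by ext; simp
  map_mul' a b := by ext; simp [mul_assoc]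
  map_zero' := by ext; simp
  map_add' a b := by ext; simp

variable (𝕜) in
/-- Right multiplication as a ring homomorphism into bounded operators. -/
noncomputable def rmulHom : Rᵐᵒᵖ →+* (R →L[𝕜] R) where
  toFun a := (ContinuousLinearMap.mul 𝕜 R).flip a.unop
  map_one' := by ext; simp
  map_mul' a b := by ext; simp [mul_assoc]
  map_zero' := by ext; simp
  map_add' a b := by ext; simp

/-- Left and right multiplications commute, so the exponential of the sum factors. This serves both
for the Sylvester operator and for `e^{ad X}`. -/
lemma exp_mul_add_mul_flip_apply (a b h : R) :
    exp (ContinuousLinearMap.mul 𝕜 R a + (ContinuousLinearMap.mul 𝕜 R).flip b) h =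
      exp a * h * exp b := by
  let := NormedAlgebra.restrictScalars ℚ 𝕜 R
  let := NormedAlgebra.restrictScalars ℚ 𝕜 (R →L[𝕜] R)
  have h1 : lmulHom 𝕜 (exp a) = exp (lmulHom 𝕜 a) :=
    map_exp (lmulHom 𝕜) (ContinuousLinearMap.mul 𝕜 R).continuous a
  have h2 : rmulHom 𝕜 (exp (MulOpposite.op b)) = exp (rmulHom 𝕜 (MulOpposite.op b)) :=
    map_exp (rmulHom 𝕜)
      ((ContinuousLinearMap.mul 𝕜 R).flip.continuous.comp MulOpposite.continuous_unop) _
  have hc : Commute (lmulHom 𝕜 a) (rmulHom 𝕜 (MulOpposite.op b)) := by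
    ext x
    simp [lmulHom, rmulHom, mul_assoc]
  have h3 := NormedSpace.exp_add_of_commute hc
  rw [← h1, ← h2] at h3
  have h4 := congrArg (fun T : R →L[𝕜] R => T h) h3
  simp only [exp_op, lmulHom, rmulHom, RingHom.coe_mk, MonoidHom.coe_mk, OneHom.coe_mk,
    MulOpposite.unop_op, ContinuousLinearMap.mul_apply', mul_apply_eq_comp,
    ContinuousLinearMap.flip_apply, mul_assoc] at h4 ⊢
  exact h4

end MulExp

/-! ### Invertibility of the derivative of the exponential -/

section Dexp

variable {𝒜 : Type*} [CStarAlgebra 𝒜]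

lemma norm_exp_neg_lt_one {a : 𝒜} (ha : a ∈ posCone 𝒜) : ‖exp (-a)‖ < 1 := by
  let := CStarAlgebra.spectralOrder 𝒜
  have := CStarAlgebra.spectralOrderedRing 𝒜
  rw [mem_posCone_iff] at ha
  have hsa := IsSelfAdjoint.of_nonneg ha.nonneg
  rw [← CFC.real_exp_eq_normedSpace_exp hsa.neg, ← cfc_comp_neg ..,
    norm_cfc_lt_iff _ _ one_pos]
  intro t ht
  have ht0 : 0 < t := ha.spectrum_pos ht
  rw [Real.norm_of_nonneg (Real.exp_pos _).le]
  exact (Real.exp_lt_exp.2 (neg_lt_zero.2 ht0)).trans_eq Real.exp_zero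

/-- The Sylvester operator `h ↦ ah + ha` of a positive invertible element is invertible. -/
lemma bijective_mul_add_mul {a : 𝒜} (ha : a ∈ posCone 𝒜) :
    Function.Bijective fun h : 𝒜 => a * h + h * a := by
  set M : 𝒜 →L[ℂ] 𝒜 :=
    ContinuousLinearMap.mul ℂ 𝒜 (-a) + (ContinuousLinearMap.mul ℂ 𝒜).flip (-a) with hM
  -- If `0` were in the spectrum of `M`, then `1 = e^0` would be in that of `exp M`, which is `h ↦
  -- e^{-a} h e^{-a}` and has norm below `1`.
  have hunit : IsUnit M := by
    by_contra hM0
    have h0 : (0 : ℂ) ∈ spectrum ℂ M := spectrum.zero_mem ℂ hM0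
    have h1 := spectrum.exp_mem_exp M h0
    rw [exp_zero] at h1
    have h2 := spectrum.norm_le_norm_mul_of_mem h1
    have h3 : ‖exp M‖ ≤ ‖exp (-a)‖ * ‖exp (-a)‖ :=
      ContinuousLinearMap.opNorm_le_bound _ (by positivity) fun h => by
        rw [hM, exp_mul_add_mul_flip_apply, mul_right_comm]
        exact (norm_mul_le _ _).trans
          (mul_le_mul_of_nonneg_right (norm_mul_le _ _) (norm_nonneg _))
    have h4 := norm_exp_neg_lt_one ha
    have h5 : ‖(1 : 𝒜 →L[ℂ] 𝒜)‖ ≤ 1 := ContinuousLinearMap.norm_id_le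
    rw [norm_one] at h2
    have h6 : ‖exp M‖ < 1 := h3.trans_lt (by nlinarith [norm_nonneg (exp (-a))])
    nlinarith [norm_nonneg (exp M), norm_nonneg (1 : 𝒜 →L[ℂ] 𝒜)]
  have hb : Function.Bijective M := ContinuousLinearMap.isUnit_iff_bijective.1 hunit
  have : (fun h : 𝒜 => a * h + h * a) = fun h => -M h := by
    ext h; simp [hM]; abel
  rw [this]
  exact (neg_involutive.bijective).comp hb

/-- The derivative of the exponential. -/
noncomputable def dexp (X : 𝒜) : 𝒜 →L[ℝ] 𝒜 := fderiv ℝ exp X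

lemma contDiff_exp {n : WithTop ℕ∞} : ContDiff ℝ n (exp : 𝒜 → 𝒜) :=
  contDiff_iff_contDiffAt.2 fun x => (exp_analytic (𝕂 := ℝ) x).contDiffAt

lemma hasFDerivAt_exp' (X : 𝒜) : HasFDerivAt exp (dexp X) X :=
  (exp_analytic (𝕂 := ℝ) X).differentiableAt.hasFDerivAt

lemma hasStrictFDerivAt_exp' (X : 𝒜) : HasStrictFDerivAt exp (dexp X) X :=
  contDiff_exp.contDiffAt.hasStrictFDerivAt' (hasFDerivAt_exp' X) one_ne_zero

lemma continuous_dexp : Continuous (dexp : 𝒜 → 𝒜 →L[ℝ] 𝒜) :=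
  contDiff_exp.continuous_fderiv one_ne_zero

lemma dexp_zero : dexp (0 : 𝒜) = 1 :=
  (hasFDerivAt_exp_zero (𝕂 := ℝ)).fderiv

/-- Differentiate `e^{2X} = e^X e^X`. This doubling rule replaces a closed formula for the
derivative: properties near `0` propagate to all `X`. -/
lemma dexp_two_smul (X h : 𝒜) :
    dexp ((2 : ℝ) • X) h = (1 / 2 : ℝ) • (exp X * dexp X h + dexp X h * exp X) := by
  have h1 : HasFDerivAt (fun Y : 𝒜 => exp ((2 : ℝ) • Y)) _ X :=
    (hasFDerivAt_exp' ((2 : ℝ) • X)).comp X ((hasFDerivAt_id X).const_smul (2 : ℝ))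
  have h2 := (hasFDerivAt_exp' X).mul' (hasFDerivAt_exp' X)
  simp only [exp_two_smul] at h1
  have h3 := congrArg (fun T : 𝒜 →L[ℝ] 𝒜 => (1 / 2 : ℝ) • T h) (h1.unique h2)
  simpa using h3

lemma star_dexp {X : 𝒜} (hX : IsSelfAdjoint X) (h : 𝒜) : star (dexp X h) = dexp X (star h) := by
  have h1 : HasFDerivAt (fun Y : 𝒜 => star (exp Y)) _ X :=
    ((starL' ℝ : 𝒜 ≃L[ℝ] 𝒜).hasFDerivAt (x := exp X)).comp X (hasFDerivAt_exp' X)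
  have h2 : HasFDerivAt (fun Y : 𝒜 => exp (star Y)) _ X :=
    HasFDerivAt.comp X (by rw [hX.star_eq]; exact hasFDerivAt_exp' X)
      ((starL' ℝ : 𝒜 ≃L[ℝ] 𝒜).hasFDerivAt (x := X))
  simp only [star_exp] at h1
  have h3 := congrArg (fun T : 𝒜 →L[ℝ] 𝒜 => T h) (h1.unique h2)
  simpa using h3

lemma tendsto_pow_smul_zero (X : 𝒜) :
    Tendsto (fun n : ℕ => ((1 / 2 : ℝ) ^ n) • X) atTop (𝓝 0) := by
  have := (tendsto_pow_atTop_nhds_zero_of_lt_one (r := (1 / 2 : ℝ)) (by norm_num)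
    (by norm_num)).smul_const X
  simpa using this

lemma pow_smul_eq_two_smul (X : 𝒜) (n : ℕ) :
    ((1 / 2 : ℝ) ^ n) • X = (2 : ℝ) • ((1 / 2 : ℝ) ^ (n + 1)) • X := by
  rw [smul_smul]; congr 1; ring

/-- At `X/2^n` with `n` large the derivative is close to the identity, hence invertible; each
doubling composes it with an invertible Sylvester operator. -/
lemma isUnit_dexp {X : 𝒜} (hX : IsSelfAdjoint X) : IsUnit (dexp X) := by
  have hstep : ∀ Y : 𝒜, IsSelfAdjoint Y → IsUnit (dexp Y) → IsUnit (dexp ((2 : ℝ) • Y)) := by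
    intro Y hY hu
    rw [ContinuousLinearMap.isUnit_iff_bijective] at hu ⊢
    have h1 : (dexp ((2 : ℝ) • Y) : 𝒜 → 𝒜) = (fun h => (1 / 2 : ℝ) • h) ∘
        (fun h => exp Y * h + h * exp Y) ∘ dexp Y := by
      ext h; exact dexp_two_smul Y h
    rw [h1]
    exact (MulAction.bijective₀ (by norm_num : (1 / 2 : ℝ) ≠ 0)).comp
      ((bijective_mul_add_mul (exp_mem_posCone hY)).comp hu)
  have hlim : Tendsto (fun n : ℕ => dexp (((1 / 2 : ℝ) ^ n) • X)) atTop (𝓝 1) := by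
    rw [← dexp_zero]
    exact (continuous_dexp.tendsto 0).comp (tendsto_pow_smul_zero X)
  obtain ⟨n, hn⟩ := (hlim.eventually (Units.isOpen.mem_nhds isUnit_one)).exists
  have : ∀ n : ℕ, IsUnit (dexp (((1 / 2 : ℝ) ^ n) • X)) → IsUnit (dexp X) := by
    intro n
    induction n with
    | zero => simp
    | succ n ih =>
      intro h
      apply ih
      rw [pow_smul_eq_two_smul]
      exact hstep _ (isSelfAdjoint_smul hX _) h
  exact this n hn

/-- The logarithm of a differentiable curve in the positive cone is differentiable. -/
lemma exists_hasDerivWithinAt_log {γ : ℝ → 𝒜} {γ' : 𝒜} {s : Set ℝ} {t : ℝ}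
    (hγ : HasDerivWithinAt γ γ' s t) (hs : ∀ u ∈ s, γ u ∈ posCone 𝒜) (ht : t ∈ s) :
    ∃ u, HasDerivWithinAt (fun r => CFC.log (γ r)) u s t ∧ dexp (CFC.log (γ t)) u = γ' := by
  set X := CFC.log (γ t) with hX
  have hXsa : IsSelfAdjoint X := IsSelfAdjoint.log
  have hexp : exp X = γ t := exp_log_of_mem_posCone (hs t ht)
  have hb : Function.Bijective (dexp X) :=
    ContinuousLinearMap.isUnit_iff_bijective.1 (isUnit_dexp hXsa)
  let e : 𝒜 ≃L[ℝ] 𝒜 := ContinuousLinearEquiv.ofBijective (dexp X)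
    (LinearMap.ker_eq_bot.2 hb.1) (LinearMap.range_eq_top.2 hb.2)
  have he : (e : 𝒜 →L[ℝ] 𝒜) = dexp X := by ext; rfl
  -- The inverse function theorem gives a differentiable local inverse of `exp`; continuity of the
  -- logarithm identifies it with the logarithm along the curve.
  have hst : HasStrictFDerivAt exp (e : 𝒜 →L[ℝ] 𝒜) X := by
    rw [he]; exact hasStrictFDerivAt_exp' X
  have hinv := hst.to_localInverse.hasFDerivAt
  rw [hexp] at hinv
  refine ⟨e.symm γ', ?_, ?_⟩
  · refine (hinv.comp_hasDerivWithinAt t hγ).congr_of_eventuallyEq ?_ ?_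
    · have hcont : Tendsto (fun r => CFC.log (γ r)) (𝓝[s] t) (𝓝 X) :=
        ((continuousOn_log_posCone (γ t) (hs t ht)).tendsto).comp
          (tendsto_nhdsWithin_iff.2 ⟨hγ.continuousWithinAt, eventually_mem_nhdsWithin.mono hs⟩)
      filter_upwards [hcont.eventually hst.eventually_left_inverse, eventually_mem_nhdsWithin]
        with r hr hrs
      rw [exp_log_of_mem_posCone (hs r hrs)] at hr
      exact hr.symm
    · have := hst.localInverse_apply_image
      rw [hexp] at this
      exact this.symm
  · rw [← he]; simp

end Dexp
end FiniteVN

namespace FiniteVN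

open NormedSpace Filter Topology

/-! ### The translated derivative as a product of hyperbolic cosines -/

section Ndexp

universe u

variable {𝒜 : Type u} [CStarAlgebra 𝒜] {τ : 𝒜 →ₗ[ℂ] ℂ}

/-- The derivative of the exponential at `X`, translated to the identity. -/
noncomputable def ndexp (X : 𝒜) : 𝒜 →L[ℝ] 𝒜 :=
  ContinuousLinearMap.mulLeftRight ℝ 𝒜 (exp ((-1 / 2 : ℝ) • X)) (exp ((-1 / 2 : ℝ) • X)) * dexp X

/-- The operator `cosh (ad X)`. -/
noncomputable def coshAd (X : 𝒜) : 𝒜 →L[ℝ] 𝒜 :=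
  (1 / 2 : ℝ) • (ContinuousLinearMap.mulLeftRight ℝ 𝒜 (exp (-X)) (exp X) +
    ContinuousLinearMap.mulLeftRight ℝ 𝒜 (exp X) (exp (-X)))

lemma ndexp_apply (X h : 𝒜) :
    ndexp X h = exp ((-1 / 2 : ℝ) • X) * dexp X h * exp ((-1 / 2 : ℝ) • X) := by
  simp [ndexp]

lemma coshAd_apply (X h : 𝒜) :
    coshAd X h = (1 / 2 : ℝ) • (exp (-X) * h * exp X + exp X * h * exp (-X)) := by
  simp [coshAd]

lemma continuous_ndexp : Continuous (ndexp : 𝒜 → 𝒜 →L[ℝ] 𝒜) := by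
  have h1 := continuous_exp (𝒜 := 𝒜)
  have h2 := continuous_dexp (𝒜 := 𝒜)
  unfold ndexp
  fun_prop

lemma ndexp_zero : ndexp (0 : 𝒜) = 1 := by
  ext h; simp [ndexp_apply, dexp_zero]

lemma dexp_apply_eq (X h : 𝒜) :
    dexp X h = exp ((1 / 2 : ℝ) • X) * ndexp X h * exp ((1 / 2 : ℝ) • X) := by
  have e1 : exp ((1 / 2 : ℝ) • X) * exp ((-1 / 2 : ℝ) • X) = 1 := by
    rw [← exp_smul_add]; norm_num
  have e2 : exp ((-1 / 2 : ℝ) • X) * exp ((1 / 2 : ℝ) • X) = 1 := by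
    rw [← exp_smul_add]; norm_num
  rw [ndexp_apply]
  calc dexp X h = 1 * dexp X h * 1 := by simp
    _ = _ := by rw [← e1]; nth_rewrite 2 [e1]; rw [← e2]; simp only [mul_assoc]

/-- Iterating gives the operator form of `sinh(a/2)/(a/2) = cosh(a/4) cosh(a/8) ⋯` with `a = ad X`.
Invariant subspaces and norm bounds for the derivative thus reduce to those of a single cosine. -/
lemma ndexp_two_smul (X : 𝒜) : ndexp ((2 : ℝ) • X) = coshAd ((1 / 2 : ℝ) • X) * ndexp X := by
  ext h
  have e1 : exp ((-1 / 2 : ℝ) • (2 : ℝ) • X) = exp (-((1 / 2 : ℝ) • X)) * exp (-((1 / 2 : ℝ) • X)) := by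
    rw [← neg_smul, ← exp_smul_add, smul_smul]; norm_num
  have e2 : exp X = exp ((1 / 2 : ℝ) • X) * exp ((1 / 2 : ℝ) • X) := exp_eq_half_mul_half X
  rw [mul_apply_eq_comp, ndexp_apply, dexp_two_smul, dexp_apply_eq X h,
    coshAd_apply, e1, e2]
  simp only [mul_smul_comm, smul_mul_assoc, mul_add, add_mul, mul_assoc, exp_neg_mul_exp_mul,
    exp_mul_exp_neg_mul, exp_mul_exp_neg, mul_one]
  rw [add_comm]

lemma isSelfAdjoint_coshAd {X h : 𝒜} (hX : IsSelfAdjoint X) (hh : IsSelfAdjoint h) :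
    IsSelfAdjoint (coshAd X h) := by
  rw [coshAd_apply]
  refine isSelfAdjoint_smul ?_ _
  rw [IsSelfAdjoint, star_add, star_mul, star_mul, star_mul, star_mul, star_exp, star_exp,
    star_neg, hX.star_eq, hh.star_eq, add_comm]
  simp only [mul_assoc]

lemma isSelfAdjoint_ndexp {X h : 𝒜} (hX : IsSelfAdjoint X) (hh : IsSelfAdjoint h) :
    IsSelfAdjoint (ndexp X h) := by
  have h1 := (IsSelfAdjoint.exp (isSelfAdjoint_smul hX (-1 / 2)))
  rw [ndexp_apply, IsSelfAdjoint, star_mul, star_mul, h1.star_eq, star_dexp hX, hh.star_eq,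
    mul_assoc]

lemma isUnit_ndexp {X : 𝒜} (hX : IsSelfAdjoint X) : IsUnit (ndexp X) := by
  refine IsUnit.mul ?_ (isUnit_dexp hX)
  refine isUnit_iff_exists.2 ⟨ContinuousLinearMap.mulLeftRight ℝ 𝒜 (exp (-((-1 / 2 : ℝ) • X)))
    (exp (-((-1 / 2 : ℝ) • X))), ?_, ?_⟩
  all_goals
    ext h
    simp only [mul_apply_eq_comp, ContinuousLinearMap.mulLeftRight_apply,
      one_apply_eq_self]
    simp only [mul_assoc, exp_mul_exp_neg_mul, exp_neg_mul_exp_mul, exp_mul_exp_neg,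
      exp_neg_mul_exp, mul_one]

lemma ndexp_two_pow (X : 𝒜) (n : ℕ) :
    ndexp (((1 / 2 : ℝ) ^ n) • X) =
      coshAd (((1 / 2 : ℝ) ^ (n + 2)) • X) * ndexp (((1 / 2 : ℝ) ^ (n + 1)) • X) := by
  rw [pow_smul_eq_two_smul, ndexp_two_smul, smul_smul]
  congr 3
  ring

/-- `ndexp X` preserves the closed subspaces that `cosh (ad tX)` preserves. -/
lemma ndexp_mem_of_coshAd_mem {X : 𝒜} {W : Submodule ℝ 𝒜} (hW : IsClosed (W : Set 𝒜))
    (hcosh : ∀ t : ℝ, ∀ h ∈ W, coshAd (t • X) h ∈ W) {h : 𝒜} (hh : h ∈ W) : ndexp X h ∈ W := by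
  have h1 : ∀ n : ℕ, ∃ C : 𝒜 →L[ℝ] 𝒜, (∀ k ∈ W, C k ∈ W) ∧
      ndexp X = C * ndexp (((1 / 2 : ℝ) ^ n) • X) := by
    intro n
    induction n with
    | zero => exact ⟨1, fun k hk => hk, by simp⟩
    | succ n ih =>
      obtain ⟨C, hC, hC'⟩ := ih
      refine ⟨C * coshAd (((1 / 2 : ℝ) ^ (n + 2)) • X), fun k hk => hC _ (hcosh _ _ hk), ?_⟩
      rw [hC', ndexp_two_pow, mul_assoc]
  choose C hC hC' using h1
  have hlim : Tendsto (fun n : ℕ => ndexp (((1 / 2 : ℝ) ^ n) • X)) atTop (𝓝 1) := by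
    rw [← ndexp_zero]
    exact (continuous_ndexp.tendsto 0).comp (tendsto_pow_smul_zero X)
  have hinv : Tendsto (fun n : ℕ => Ring.inverse (ndexp (((1 / 2 : ℝ) ^ n) • X))) atTop (𝓝 1) := by
    have := (NormedRing.inverse_continuousAt (1 : (𝒜 →L[ℝ] 𝒜)ˣ)).tendsto.comp
      (by simpa using hlim)
    simpa [Function.comp_def] using this
  -- The partial products satisfy `C n = ndexp X * (ndexp (X/2^n))⁻¹` for large `n`, and the second
  -- factor tends to the identity.
  have hCn : Tendsto (fun n => C n h) atTop (𝓝 (ndexp X h)) := by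
    have h2 : Tendsto (fun n : ℕ => (ndexp X * Ring.inverse (ndexp (((1 / 2 : ℝ) ^ n) • X))) h)
        atTop (𝓝 ((ndexp X * 1) h)) :=
      ((ContinuousLinearMap.apply ℝ 𝒜 h).continuous.tendsto _).comp (hinv.const_mul (ndexp X))
    rw [mul_one] at h2
    refine h2.congr' ?_
    filter_upwards [hlim.eventually (Units.isOpen.mem_nhds isUnit_one)] with n hn
    rw [hC' n, mul_assoc, Ring.mul_inverse_cancel _ hn, mul_one]
  exact hW.mem_of_tendsto hCn (Eventually.of_forall fun n => hC n h hh)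

/-- `cosh (ad X)` preserves the closed subspaces that `(ad X)²` preserves. -/
lemma coshAd_mem {X : 𝒜} {W : Submodule ℝ 𝒜} (hW : IsClosed (W : Set 𝒜))
    (had : ∀ h ∈ W, ⁅X, ⁅X, h⁆⁆ ∈ W) {h : 𝒜} (hh : h ∈ W) : coshAd X h ∈ W := by
  set Z : 𝒜 →L[ℝ] 𝒜 :=
    ContinuousLinearMap.mul ℝ 𝒜 X + (ContinuousLinearMap.mul ℝ 𝒜).flip (-X) with hZ
  have hZa : ∀ k, Z k = ⁅X, k⁆ := fun k => by
    simp [hZ, Ring.lie_def, sub_eq_add_neg]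
  have hZn : -Z = ContinuousLinearMap.mul ℝ 𝒜 (-X) +
      (ContinuousLinearMap.mul ℝ 𝒜).flip (- -X) := by
    ext k; simp [hZ, add_comm]
  have h1 : coshAd X h = (1 / 2 : ℝ) • (exp Z h + exp (-Z) h) := by
    rw [hZn, hZ, exp_mul_add_mul_flip_apply, exp_mul_add_mul_flip_apply, coshAd_apply, neg_neg,
      add_comm]
  -- Only even powers of `ad X` occur in the cosine, so invariance under `(ad X)²` suffices; this is
  -- where the Lie triple condition fits.
  have hpow : ∀ n : ℕ, (Z ^ (2 * n)) h ∈ W := by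
    intro n
    induction n with
    | zero => simpa
    | succ n ih =>
      rw [show 2 * (n + 1) = 2 * n + 1 + 1 by ring, pow_succ', pow_succ', ]
      simp only [mul_apply_eq_comp, hZa]
      exact had _ ih
  have hs := (exp_series_hasSum_exp' (𝕂 := ℝ) Z).add (exp_series_hasSum_exp' (𝕂 := ℝ) (-Z))
  have hs' := (ContinuousLinearMap.apply ℝ 𝒜 h).hasSum hs
  rw [h1]
  refine W.smul_mem _ (hW.mem_of_tendsto hs' (Eventually.of_forall fun s => W.sum_mem fun n _ => ?_))
  rcases Nat.even_or_odd' n with ⟨m, rfl | rfl⟩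
  · change ((_ : ℝ) • Z ^ (2 * m) + (_ : ℝ) • (-Z) ^ (2 * m)) h ∈ W
    rw [show (-Z) ^ (2 * m) = Z ^ (2 * m) from Even.neg_pow (even_two_mul m) Z]
    exact W.add_mem (W.smul_mem _ (hpow m)) (W.smul_mem _ (hpow m))
  · change ((_ : ℝ) • Z ^ (2 * m + 1) + (_ : ℝ) • (-Z) ^ (2 * m + 1)) h ∈ W
    rw [show (-Z) ^ (2 * m + 1) = -Z ^ (2 * m + 1) from Odd.neg_pow (odd_two_mul_add_one m) Z,
      smul_neg, add_neg_cancel]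
    exact W.zero_mem

variable (hτ : IsFaithfulTrace τ)
include hτ

lemma IsFaithfulTrace.ip_coshAd (X h k : 𝒜) : ip τ (coshAd X h) k = ip τ h (coshAd X k) := by
  have key : ∀ Y : 𝒜, ip τ (exp (-Y) * h * exp Y) k = ip τ h (exp Y * k * exp (-Y)) := fun Y => by
    rw [ip, ip, mul_assoc, mul_assoc, hτ.tracial]
    simp only [mul_assoc]
  have h2 := key (-X)
  rw [neg_neg] at h2
  rw [coshAd_apply, coshAd_apply, ip_smul_left, ip_smul_right, ip_add_left, ip_add_right, key, h2,
    add_comm]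

/-- With `p = e^{X/2} h e^{-X/2}`, traciality gives `τ(p²) = ‖h‖₂²` and `‖p‖₂² = τ(cosh(ad X)(h)
h)`. Two applications of Cauchy–Schwarz yield `‖h‖₂² ≤ ‖p‖₂² ≤ ‖cosh(ad X) h‖₂ ‖h‖₂`. -/
lemma IsFaithfulTrace.nrm_le_nrm_coshAd {X h : 𝒜} (hX : IsSelfAdjoint X) (hh : IsSelfAdjoint h) :
    nrm τ h ≤ nrm τ (coshAd X h) := by
  set m := exp ((1 / 2 : ℝ) • X) with hm
  set m' := exp (-((1 / 2 : ℝ) • X)) with hm'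
  have hmm : exp X = m * m := exp_eq_half_mul_half X
  have hmm' : exp (-X) = m' * m' := by rw [exp_eq_half_mul_half, smul_neg]
  have c1 : ∀ a, m * (m' * a) = a := exp_mul_exp_neg_mul _
  have c2 : ∀ a, m' * (m * a) = a := exp_neg_mul_exp_mul _
  have c3 : m' * m = 1 := exp_neg_mul_exp _
  have hmsa : star m = m := (IsSelfAdjoint.exp (isSelfAdjoint_smul hX _)).star_eq
  have hmsa' : star m' = m' := (IsSelfAdjoint.exp (isSelfAdjoint_smul hX _).neg).star_eq
  set p := m * h * m' with hp
  have hsp : star p = m' * h * m := by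
    rw [hp, star_mul, star_mul, hmsa, hmsa', hh.star_eq, mul_assoc]
  have h1 : ip τ p p = nrm τ h ^ 2 := by
    rw [hτ.nrm_sq_of_isSelfAdjoint hh, ip, ip, hp, hτ.tracial]
    simp only [mul_assoc, c2]
    rw [hτ.tracial]
    simp only [mul_assoc, c3, mul_one]
  have h2 : nrm τ p ^ 2 = ip τ (exp X * h * exp (-X)) h := by
    rw [hτ.nrm_sq, hsp, hp, ip, ip, hmm, hmm',
      show m' * h * m * (m * h * m') = m' * (h * (m * m * h * m')) by simp only [mul_assoc],
      hτ.tracial, mul_assoc, hτ.tracial]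
    simp only [mul_assoc]
  have h3 : nrm τ p ^ 2 = ip τ (exp (-X) * h * exp X) h := by
    rw [h2, ip, ip, hτ.tracial, ← mul_assoc, hτ.tracial]
    simp only [mul_assoc]
  have h4 : nrm τ h ^ 2 ≤ nrm τ p ^ 2 := by
    rw [← h1, sq]
    exact (le_abs_self _).trans (hτ.abs_ip_le _ _)
  have h5 : nrm τ p ^ 2 = ip τ (coshAd X h) h := by
    rw [coshAd_apply, ip_smul_left, ip_add_left, ← h2, ← h3]; ring
  have h6 : nrm τ h ^ 2 ≤ nrm τ (coshAd X h) * nrm τ h :=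
    (h4.trans_eq h5).trans ((le_abs_self _).trans (hτ.abs_ip_le _ _))
  rcases (nrm_nonneg (τ := τ) h).eq_or_lt with h0 | h0
  · rw [← h0]; exact nrm_nonneg _
  · nlinarith

/-- The exponential metric increasing property. -/
lemma IsFaithfulTrace.nrm_le_nrm_ndexp {X h : 𝒜} (hX : IsSelfAdjoint X) (hh : IsSelfAdjoint h) :
    nrm τ h ≤ nrm τ (ndexp X h) := by
  have h1 : ∀ n : ℕ, nrm τ (ndexp (((1 / 2 : ℝ) ^ n) • X) h) ≤ nrm τ (ndexp X h) := by
    intro n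
    induction n with
    | zero => simp
    | succ n ih =>
      refine le_trans ?_ ih
      rw [ndexp_two_pow X n, mul_apply_eq_comp]
      exact hτ.nrm_le_nrm_coshAd (isSelfAdjoint_smul hX _)
        (isSelfAdjoint_ndexp (isSelfAdjoint_smul hX _) hh)
  have hlim : Tendsto (fun n : ℕ => nrm τ (ndexp (((1 / 2 : ℝ) ^ n) • X) h)) atTop (𝓝 (nrm τ h)) := by
    have h2 : Tendsto (fun n : ℕ => ndexp (((1 / 2 : ℝ) ^ n) • X) h) atTop
        (𝓝 (ndexp (0 : 𝒜) h)) :=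
      ((ContinuousLinearMap.apply ℝ 𝒜 h).continuous.tendsto _).comp
        ((continuous_ndexp.tendsto 0).comp (tendsto_pow_smul_zero X))
    rw [ndexp_zero] at h2
    exact (hτ.continuous_nrm.tendsto _).comp h2
  exact le_of_tendsto' hlim h1

end Ndexp
end FiniteVN

namespace FiniteVN

open NormedSpace Filter Topology

/-! ### The geodesic distance: invariance, lower bound and first variation -/

section Distance

universe u

variable {𝒜 : Type u} [CStarAlgebra 𝒜] {τ : 𝒜 →ₗ[ℂ] ℂ}

lemma inverse_exp (X : 𝒜) : Ring.inverse (exp X) = exp (-X) :=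
  let := NormedAlgebra.restrictScalars ℚ ℂ 𝒜
  Ring.inverse_exp X

/-- The velocity of a curve at `t`. -/
noncomputable def speed (τ : 𝒜 →ₗ[ℂ] ℂ) (γ : ℝ → 𝒜) (t : ℝ) : ℝ :=
  √(metricInner τ (γ t) (derivWithin γ (Icc 0 1) t) (derivWithin γ (Icc 0 1) t))

lemma curveLength_nonneg (γ : ℝ → 𝒜) : 0 ≤ curveLength τ γ :=
  intervalIntegral.integral_nonneg zero_le_one fun _ _ => Real.sqrt_nonneg _

lemma geodesicDist_le {a b : 𝒜} {γ : ℝ → 𝒜} (hγ : IsCurveJoining a b γ) :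
    geodesicDist τ a b ≤ curveLength τ γ :=
  csInf_le ⟨0, by rintro _ ⟨δ, -, rfl⟩; exact curveLength_nonneg δ⟩ ⟨γ, hγ, rfl⟩

lemma exists_isCurveJoining {a b : 𝒜} (ha : a ∈ posCone 𝒜) (hb : b ∈ posCone 𝒜) :
    ∃ γ, IsCurveJoining a b γ :=
  ⟨fun s => (1 - s) • a + s • b, by fun_prop, fun _ ht => segment_mem_posCone ha hb ht,
    by simp, by simp⟩

lemma le_geodesicDist {a b : 𝒜} (ha : a ∈ posCone 𝒜) (hb : b ∈ posCone 𝒜) {r : ℝ}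
    (h : ∀ γ, IsCurveJoining a b γ → r ≤ curveLength τ γ) : r ≤ geodesicDist τ a b := by
  obtain ⟨γ, hγ⟩ := exists_isCurveJoining ha hb
  refine le_csInf ⟨_, γ, hγ, rfl⟩ ?_
  rintro _ ⟨δ, hδ, rfl⟩
  exact h δ hδ

lemma geodesicDist_nonneg (a b : 𝒜) : 0 ≤ geodesicDist τ a b :=
  Real.sInf_nonneg (by rintro _ ⟨δ, -, rfl⟩; exact curveLength_nonneg δ)

lemma isSelfAdjoint_derivWithin {γ : ℝ → 𝒜} {γ' : 𝒜} {t : ℝ} (ht : t ∈ Icc (0 : ℝ) 1)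
    (hγ : HasDerivWithinAt γ γ' (Icc 0 1) t) (hsa : ∀ s ∈ Icc (0 : ℝ) 1, IsSelfAdjoint (γ s)) :
    IsSelfAdjoint γ' := by
  have h1 := ((starL' ℝ : 𝒜 ≃L[ℝ] 𝒜).hasFDerivAt (x := γ t)).comp_hasDerivWithinAt t hγ
  have h2 : HasDerivWithinAt γ (star γ') (Icc 0 1) t :=
    h1.congr (fun s hs => (hsa s hs).star_eq.symm) (hsa t ht).star_eq.symm
  exact (uniqueDiffOn_Icc_zero_one t ht).eq_deriv _ h2 hγ

namespace IsFaithfulTrace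

variable (hτ : IsFaithfulTrace τ)
include hτ

lemma metricInner_exp {X v : 𝒜} (hX : IsSelfAdjoint X) (hv : IsSelfAdjoint v) :
    metricInner τ (exp X) v v =
      nrm τ (exp ((-1 / 2 : ℝ) • X) * v * exp ((-1 / 2 : ℝ) • X)) ^ 2 := by
  set m := exp ((-1 / 2 : ℝ) • X) with hm
  have hmm : exp (-X) = m * m := by
    rw [hm, ← exp_smul_add]; norm_num
  have hmsa : star m = m := (IsSelfAdjoint.exp (isSelfAdjoint_smul hX _)).star_eq
  rw [hτ.nrm_sq, star_mul, star_mul, hmsa, hv.star_eq, ip, metricInner, inverse_exp, hmm]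
  rw [show m * (v * m) * (m * v * m) = m * (v * m * m * v * m) by simp only [mul_assoc],
    hτ.tracial m]
  simp only [mul_assoc]

lemma metricInner_congr {a v g : 𝒜} (hg : IsUnit g) (ha : IsUnit a) :
    metricInner τ (g * a * g) (g * v * g) (g * v * g) = metricInner τ a v v := by
  have h1 : Ring.inverse (g * a * g) = Ring.inverse g * Ring.inverse a * Ring.inverse g := by
    obtain ⟨u, rfl⟩ := hg
    obtain ⟨b, rfl⟩ := ha
    rw [← Units.val_mul, ← Units.val_mul, Ring.inverse_unit, Ring.inverse_unit, Ring.inverse_unit]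
    simp [mul_assoc]
  have h2 : ∀ b, g * (Ring.inverse g * b) = b := fun b => by
    rw [← mul_assoc, Ring.mul_inverse_cancel _ hg, one_mul]
  have h3 : ∀ b, Ring.inverse g * (g * b) = b := fun b => by
    rw [← mul_assoc, Ring.inverse_mul_cancel _ hg, one_mul]
  rw [metricInner, metricInner, h1, mul_assoc g v, mul_assoc g, mul_assoc g, mul_assoc g,
    hτ.tracial]
  simp only [mul_assoc, h2, h3, Ring.inverse_mul_cancel _ hg, mul_one]

lemma continuousOn_speed {γ : ℝ → 𝒜} {a b : 𝒜} (hγ : IsCurveJoining a b γ) :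
    ContinuousOn (speed τ γ) (Icc 0 1) := by
  have h1 : ContinuousOn (derivWithin γ (Icc 0 1)) (Icc 0 1) :=
    hγ.contDiffOn.continuousOn_derivWithin uniqueDiffOn_Icc_zero_one le_rfl
  have h2 : ContinuousOn (fun t => Ring.inverse (γ t)) (Icc 0 1) := fun t ht => by
    obtain ⟨u, hu⟩ := isUnit_of_mem_posCone (hγ.mem_posCone t ht)
    have h3 := NormedRing.inverse_continuousAt u
    rw [hu] at h3
    exact h3.comp_continuousWithinAt (hγ.contDiffOn.continuousOn t ht)
  unfold speed metricInner
  exact (Complex.continuous_re.comp_continuousOn (hτ.continuous.comp_continuousOn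
    (((h1.mul h2).mul h1).mul h2))).sqrt

/-- The logarithm does not increase distances. -/
lemma nrm_sub_le_curveLength {a b : 𝒜} (ha : IsSelfAdjoint a) (hb : IsSelfAdjoint b) {γ : ℝ → 𝒜}
    (hγ : IsCurveJoining (exp a) (exp b) γ) : nrm τ (b - a) ≤ curveLength τ γ := by
  set c := b - a with hc
  have hcsa : IsSelfAdjoint c := hb.sub ha
  have hd : ∀ t ∈ Icc (0 : ℝ) 1,
      HasDerivWithinAt γ (derivWithin γ (Icc 0 1) t) (Icc 0 1) t := fun t ht =>
    (hγ.contDiffOn.differentiableOn one_ne_zero t ht).hasDerivWithinAt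
  have hlog : ∀ t ∈ Icc (0 : ℝ) 1, ∃ u, HasDerivWithinAt (fun r => CFC.log (γ r)) u (Icc 0 1) t ∧
      nrm τ u ≤ speed τ γ t := fun t ht => by
    obtain ⟨u, hu, hu'⟩ := exists_hasDerivWithinAt_log (hd t ht) hγ.mem_posCone ht
    refine ⟨u, hu, ?_⟩
    have hX : IsSelfAdjoint (CFC.log (γ t)) := IsSelfAdjoint.log
    have husa := isSelfAdjoint_derivWithin ht hu fun s _ => IsSelfAdjoint.log
    have hγsa := isSelfAdjoint_derivWithin ht (hd t ht)
      fun s hs => isSelfAdjoint_of_mem_posCone (hγ.mem_posCone s hs)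
    refine (hτ.nrm_le_nrm_ndexp hX husa).trans_eq ?_
    have h1 := hτ.metricInner_exp hX hγsa
    rw [exp_log_of_mem_posCone (hγ.mem_posCone t ht)] at h1
    rw [speed, h1, Real.sqrt_sq (nrm_nonneg _), ndexp_apply, hu']
  choose! u hu hu' using hlog
  -- Pairing the logarithm of the curve with `c` reduces the claim to a scalar integral inequality,
  -- which ends in `‖c‖₂² ≤ L ‖c‖₂` for the length `L`.
  let φ : 𝒜 →L[ℝ] ℝ := Complex.reCLM ∘L
    ((⟨τ, hτ.continuous⟩ : 𝒜 →L[ℂ] ℂ).restrictScalars ℝ) ∘L (ContinuousLinearMap.mul ℝ 𝒜).flip c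
  have hφ : ∀ x, φ x = ip τ x c := fun _ => rfl
  have hg : ∀ t ∈ Icc (0 : ℝ) 1,
      HasDerivWithinAt (fun r => φ (CFC.log (γ r))) (φ (u t)) (Icc 0 1) t := fun t ht =>
    φ.hasFDerivAt.comp_hasDerivWithinAt t (hu t ht)
  have key := intervalIntegral.sub_le_integral_of_hasDeriv_right_of_le zero_le_one
    (g := fun r => φ (CFC.log (γ r))) (g' := fun t => φ (u t))
    (φ := fun t => speed τ γ t * nrm τ c)
    (fun t ht => (hg t ht).continuousWithinAt)
    (fun t ht => ((hg t (Ioo_subset_Icc_self ht)).hasDerivAt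
      (Icc_mem_nhds ht.1 ht.2)).hasDerivWithinAt)
    (((hτ.continuousOn_speed hγ).mul continuousOn_const).integrableOn_Icc)
    (fun t ht => by
      have ht' := Ioo_subset_Icc_self ht
      rw [hφ]
      exact ((le_abs_self _).trans (hτ.abs_ip_le _ _)).trans
        (mul_le_mul_of_nonneg_right (hu' t ht') (nrm_nonneg _)))
  rw [intervalIntegral.integral_mul_const] at key
  have hL : ∫ t in (0 : ℝ)..1, speed τ γ t = curveLength τ γ := rfl
  simp only [hγ.source, hγ.target, CFC.log_exp a ha, CFC.log_exp b hb, hφ] at key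
  rw [hL, ← ip_sub_left, ← hc, ← hτ.nrm_sq_of_isSelfAdjoint hcsa] at key
  rcases (nrm_nonneg (τ := τ) c).eq_or_lt with h0 | h0
  · rw [← h0]; exact curveLength_nonneg γ
  · nlinarith

lemma nrm_sub_le_geodesicDist {a b : 𝒜} (ha : IsSelfAdjoint a) (hb : IsSelfAdjoint b) :
    nrm τ (a - b) ≤ geodesicDist τ (exp a) (exp b) := by
  rw [nrm_sub_comm]
  exact le_geodesicDist (exp_mem_posCone ha) (exp_mem_posCone hb)
    fun γ hγ => hτ.nrm_sub_le_curveLength ha hb hγ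

lemma geodesicDist_congr_le {a b y : 𝒜} (hy : IsSelfAdjoint y) (ha : a ∈ posCone 𝒜)
    (hb : b ∈ posCone 𝒜) :
    geodesicDist τ (exp y * a * exp y) (exp y * b * exp y) ≤ geodesicDist τ a b := by
  refine le_geodesicDist ha hb fun γ hγ => ?_
  have hδ : IsCurveJoining (exp y * a * exp y) (exp y * b * exp y)
      (fun t => exp y * γ t * exp y) :=
    ⟨(contDiffOn_const.mul hγ.contDiffOn).mul contDiffOn_const,
      fun t ht => exp_congr_mem_posCone hy (hγ.mem_posCone t ht), by simp [hγ.source],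
      by simp [hγ.target]⟩
  refine (geodesicDist_le hδ).trans_eq ?_
  refine intervalIntegral.integral_congr fun t ht => ?_
  rw [uIcc_of_le zero_le_one] at ht
  have hd := (hγ.contDiffOn.differentiableOn one_ne_zero t ht).hasDerivWithinAt
  have hd' := ((hd.const_mul (exp y)).mul_const (exp y)).derivWithin
    (uniqueDiffOn_Icc_zero_one t ht)
  simp only [hd']
  rw [hτ.metricInner_congr (isUnit_exp y) (isUnit_of_mem_posCone (hγ.mem_posCone t ht))]

lemma geodesicDist_congr {a b y : 𝒜} (hy : IsSelfAdjoint y) (ha : a ∈ posCone 𝒜)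
    (hb : b ∈ posCone 𝒜) :
    geodesicDist τ (exp y * a * exp y) (exp y * b * exp y) = geodesicDist τ a b := by
  refine (hτ.geodesicDist_congr_le hy ha hb).antisymm ?_
  have h := hτ.geodesicDist_congr_le hy.neg (exp_congr_mem_posCone hy ha)
    (exp_congr_mem_posCone hy hb)
  simpa only [mul_assoc, exp_neg_mul_exp_mul, exp_mul_exp_neg, mul_one] using h

lemma nrm_coshAd_le (X h : 𝒜) :
    nrm τ (coshAd X h) ≤ Real.exp (2 * ‖X‖) * nrm τ h := by
  have h0 := nrm_nonneg (τ := τ) h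
  have key : ∀ Y : 𝒜, ‖Y‖ = ‖X‖ → nrm τ (exp Y * h * exp (-Y)) ≤ Real.exp (2 * ‖X‖) * nrm τ h := by
    intro Y hY
    refine (hτ.nrm_mul_mul_le _ _ _).trans ?_
    have h1 := norm_exp_le Y
    have h2 := norm_exp_le (-Y)
    rw [norm_neg] at h2
    rw [hY] at h1 h2
    calc ‖exp Y‖ * nrm τ h * ‖exp (-Y)‖ ≤ Real.exp ‖X‖ * nrm τ h * Real.exp ‖X‖ := by gcongr
      _ = Real.exp (2 * ‖X‖) * nrm τ h := by rw [two_mul, Real.exp_add]; ring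
  rw [coshAd_apply, hτ.nrm_smul]
  have h1 := hτ.nrm_add_le (exp (-X) * h * exp X) (exp X * h * exp (-X))
  have h2 := key X rfl
  have h3 := key (-X) (norm_neg X)
  rw [neg_neg] at h3
  rw [abs_of_pos (by norm_num)]
  linarith

/-- A first variation inequality with a quadratic error. The curve `e^{sx/2} e^{(1-s)w} e^{sx/2}`
has speed `‖cosh(ad Y) x - w‖₂` with `Y = (1-s)w/2`. As the cosine is symmetric and fixes `w`, the
cross term is exactly `-2⟨w, x⟩`. At `x = 0` this bounds the distance to `1`. -/
lemma geodesicDist_sq_le {w x : 𝒜} (hw : IsSelfAdjoint w) (hx : IsSelfAdjoint x) :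
    geodesicDist τ (exp w) (exp x) ^ 2 ≤
      nrm τ w ^ 2 - 2 * ip τ w x + Real.exp (2 * ‖w‖) * nrm τ x ^ 2 := by
  set y : 𝒜 := (1 / 2 : ℝ) • x with hy
  have hysa : IsSelfAdjoint y := isSelfAdjoint_smul hx _
  set γ : ℝ → 𝒜 := fun s => exp (s • y) * exp ((1 - s) • w) * exp (s • y) with hγ
  have hjoin : IsCurveJoining (exp w) (exp x) γ := by
    refine ⟨?_, fun t _ => exp_congr_mem_posCone (isSelfAdjoint_smul hysa t)
      (exp_mem_posCone (isSelfAdjoint_smul hw _)), by simp [hγ], ?_⟩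
    · have := contDiff_exp (𝒜 := 𝒜) (n := 1)
      exact ContDiff.contDiffOn (by fun_prop)
    · simp only [hγ, one_smul, sub_self, zero_smul, exp_zero, mul_one]
      rw [hy, ← exp_eq_half_mul_half]
  set v : ℝ → 𝒜 := fun s => y * exp ((1 - s) • w) + exp ((1 - s) • w) * y -
    w * exp ((1 - s) • w) with hv
  have hderiv : ∀ s, HasDerivAt γ (exp (s • y) * v s * exp (s • y)) s := fun s => by
    refine (((hasDerivAt_exp_smul y s).fun_mul (hasDerivAt_exp_one_sub_smul w s)).fun_mul
      (hasDerivAt_exp_smul y s)).congr_deriv ?_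
    have hc : y * exp (s • y) = exp (s • y) * y :=
      (((Commute.refl y).smul_right s).exp_right).eq
    simp only [hv, mul_add, add_mul, mul_sub, sub_mul, mul_neg, neg_mul, mul_assoc, hc]
    abel
  set B := nrm τ w ^ 2 - 2 * ip τ w x + Real.exp (2 * ‖w‖) * nrm τ x ^ 2 with hB
  have hspeed : ∀ s ∈ Icc (0 : ℝ) 1,
      0 ≤ metricInner τ (γ s) (exp (s • y) * v s * exp (s • y))
        (exp (s • y) * v s * exp (s • y)) ∧ metricInner τ (γ s) (exp (s • y) * v s * exp (s • y))
        (exp (s • y) * v s * exp (s • y)) ≤ B := by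
    intro s hs
    set X : 𝒜 := (1 - s) • w with hX
    have hXsa : IsSelfAdjoint X := isSelfAdjoint_smul hw _
    have hcX : Commute w X := (Commute.refl w).smul_right _
    have hvsa : IsSelfAdjoint (v s) := by
      have h1 : star (exp X) = exp X := (IsSelfAdjoint.exp hXsa).star_eq
      have h2 : w * exp X = exp X * w := hcX.exp_right.eq
      rw [IsSelfAdjoint, hv]
      simp only [← hX, star_sub, star_add, star_mul, h1, hysa.star_eq, hw.star_eq, h2]
      rw [add_comm]
    set Y : 𝒜 := (1 / 2 : ℝ) • X with hY
    have hcY : Commute w Y := hcX.smul_right _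
    have e1 : exp X = exp Y * exp Y := exp_eq_half_mul_half X
    have e2 : (-1 / 2 : ℝ) • X = -Y := by rw [hY, ← neg_smul]; norm_num
    have hwY : w * exp Y = exp Y * w := hcY.exp_right.eq
    have e3 : exp (-Y) * v s * exp (-Y) = coshAd Y x - w := by
      have : x = (2 : ℝ) • y := by rw [hy, smul_smul]; norm_num
      rw [coshAd_apply, this, hv]
      simp only [← hX, e1, mul_sub, sub_mul, mul_add, add_mul, mul_smul_comm, smul_mul_assoc,
        ← smul_add, smul_smul, mul_assoc, exp_mul_exp_neg, exp_neg_mul_exp_mul, mul_one]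
      rw [hwY, exp_neg_mul_exp_mul]
      norm_num
    rw [hγ, hτ.metricInner_congr (isUnit_exp _) (isUnit_exp _), hτ.metricInner_exp hXsa hvsa, e2, e3]
    refine ⟨sq_nonneg _, ?_⟩
    have hYsa : IsSelfAdjoint Y := isSelfAdjoint_smul hXsa _
    have hcsa := isSelfAdjoint_coshAd hYsa hx
    rw [hτ.nrm_sq_of_isSelfAdjoint (hcsa.sub hw), ip_sub_left, ip_sub_right, ip_sub_right,
      ← hτ.nrm_sq_of_isSelfAdjoint hcsa, ← hτ.nrm_sq_of_isSelfAdjoint hw]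
    have e4 : coshAd Y w = w := by
      rw [coshAd_apply, mul_assoc, hwY, exp_neg_mul_exp_mul, ← hwY, mul_assoc, exp_mul_exp_neg,
        mul_one, ← two_smul ℝ w, smul_smul]
      norm_num
    have e5 : ip τ (coshAd Y x) w = ip τ w x := by rw [hτ.ip_coshAd, e4, hτ.ip_comm]
    have e6 : ip τ w (coshAd Y x) = ip τ w x := by rw [hτ.ip_comm, e5]
    have e7 : nrm τ (coshAd Y x) ^ 2 ≤ Real.exp (2 * ‖w‖) * nrm τ x ^ 2 := by
      have hYn : 2 * ‖Y‖ ≤ ‖w‖ := by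
        rw [hY, hX, smul_smul, norm_smul, Real.norm_of_nonneg (by nlinarith [hs.2])]
        nlinarith [norm_nonneg w, hs.1]
      have h1 : nrm τ (coshAd Y x) ≤ Real.exp ‖w‖ * nrm τ x :=
        (hτ.nrm_coshAd_le Y x).trans (mul_le_mul_of_nonneg_right (Real.exp_le_exp.2 hYn)
          (nrm_nonneg _))
      calc nrm τ (coshAd Y x) ^ 2 ≤ (Real.exp ‖w‖ * nrm τ x) ^ 2 :=
            pow_le_pow_left₀ (nrm_nonneg _) h1 2
        _ = _ := by rw [mul_pow, ← Real.exp_nat_mul]; norm_num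
    rw [e5, e6, hB]
    linarith
  have hlen : curveLength τ γ ≤ √B := by
    have h1 : ∀ t ∈ Icc (0 : ℝ) 1, speed τ γ t ≤ √B := fun t ht => by
      rw [speed, (hderiv t).hasDerivWithinAt.derivWithin (uniqueDiffOn_Icc_zero_one t ht)]
      exact Real.sqrt_le_sqrt (hspeed t ht).2
    have h2 := intervalIntegral.integral_mono_on (μ := MeasureTheory.volume) zero_le_one
      ((hτ.continuousOn_speed hjoin).intervalIntegrable_of_Icc zero_le_one)
      (intervalIntegrable_const (c := √B)) h1
    simpa [curveLength, speed] using h2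
  have hB0 : 0 ≤ B := by
    have h := hspeed 0 (by simp)
    exact h.1.trans h.2
  calc _ ≤ √B ^ 2 := pow_le_pow_left₀ (geodesicDist_nonneg _ _) ((geodesicDist_le hjoin).trans hlen) 2
    _ = B := Real.sq_sqrt hB0

lemma geodesicDist_exp_one {w : 𝒜} (hw : IsSelfAdjoint w) :
    geodesicDist τ (exp w) 1 = nrm τ w := by
  refine le_antisymm ?_ ?_
  · have h := hτ.geodesicDist_sq_le hw (IsSelfAdjoint.zero 𝒜)
    rw [exp_zero] at h
    refine (sq_le_sq₀ (geodesicDist_nonneg _ _) (nrm_nonneg _)).1 (h.trans_eq ?_)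
    simp [ip, nrm]
  · have h := hτ.nrm_sub_le_geodesicDist hw (IsSelfAdjoint.zero 𝒜)
    rwa [exp_zero, sub_zero] at h

end IsFaithfulTrace

end Distance
end FiniteVN

namespace FiniteVN

open NormedSpace Filter Topology

/-! ### Lie triple systems: invariance of `e^H` under congruences -/

section LieTriple

universe u

variable {𝒜 : Type u} [CStarAlgebra 𝒜] {τ : 𝒜 →ₗ[ℂ] ℂ}

/-- The bounded projection onto `H` along its orthogonal supplement. -/
lemma exists_projection {H : Submodule ℝ 𝒜} (hclosed : IsClosed (H : Set 𝒜))
    (hsupp : HasOrthogonalSupplement τ H) :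
    ∃ P : 𝒜 →L[ℝ] 𝒜, (∀ x, P x ∈ H) ∧ (∀ x ∈ H, P x = x) ∧
      ∀ x, IsSelfAdjoint x → ∀ h ∈ H, τ (h * (x - P x)) = 0 := by
  obtain ⟨S, hS, horth, hdisj, hsup⟩ := hsupp
  have hHc : CompleteSpace H := hclosed.completeSpace_coe
  have hSc : CompleteSpace S := hS.completeSpace_coe
  let f : H × S →L[ℝ] 𝒜 := H.subtypeL.coprod S.subtypeL
  have hf : ∀ p : H × S, f p = (p.1 : 𝒜) + p.2 := fun p => rfl
  have hinj : Function.Injective f := by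
    rw [injective_iff_map_eq_zero]
    rintro ⟨h, s⟩ h0
    rw [hf] at h0
    have h1 : (h : 𝒜) = -s := eq_neg_of_add_eq_zero_left h0
    have h2 : (h : 𝒜) = 0 :=
      (Submodule.disjoint_def.1 hdisj) _ h.2 (h1 ▸ S.neg_mem s.2)
    have h3 : (s : 𝒜) = 0 := by rw [h2] at h1; exact neg_eq_zero.1 h1.symm
    exact Prod.ext (Subtype.ext h2) (Subtype.ext h3)
  have hrange : ∀ x, x ∈ range f ↔ IsSelfAdjoint x := fun x => by
    have hsa : IsSelfAdjoint x ↔ x ∈ H ⊔ S := by rw [hsup]; rfl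
    rw [hsa, Submodule.mem_sup]
    constructor
    · rintro ⟨p, rfl⟩; exact ⟨p.1, p.1.2, p.2, p.2.2, rfl⟩
    · rintro ⟨h, hh, s, hs, rfl⟩; exact ⟨(⟨h, hh⟩, ⟨s, hs⟩), rfl⟩
  -- The range is all of the selfadjoint part, which is closed, so the inverse of `f` is bounded and
  -- the projection is continuous.
  have hrc : IsClosed (range f) := by
    have : range f = {x | star x = x} := by ext x; exact hrange x
    rw [this]
    exact isClosed_eq continuous_star continuous_id
  let e := f.equivRange hinj hrc
  -- Taking selfadjoint parts first extends the projection to the whole algebra.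
  let R : 𝒜 →L[ℝ] 𝒜 := (1 / 2 : ℝ) • (ContinuousLinearMap.id ℝ 𝒜 + (starL' ℝ : 𝒜 ≃L[ℝ] 𝒜))
  have hR : ∀ x, R x = (1 / 2 : ℝ) • (x + star x) := fun x => rfl
  have hRsa : ∀ x, IsSelfAdjoint (R x) := fun x => by
    rw [hR]; exact isSelfAdjoint_smul (IsSelfAdjoint.add_star_self x) _
  have hRx : ∀ x, IsSelfAdjoint x → R x = x := fun x hx => by
    rw [hR, hx.star_eq, ← two_smul ℝ x, smul_smul]; norm_num
  let R' : 𝒜 →L[ℝ] f.range := R.codRestrict _ fun x => (hrange _).2 (hRsa x)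
  let P : 𝒜 →L[ℝ] 𝒜 := H.subtypeL ∘L ContinuousLinearMap.fst ℝ H S ∘L
    (e.symm : f.range →L[ℝ] H × S) ∘L R'
  have hdecomp : ∀ x, IsSelfAdjoint x → ∃ p : H × S, x = (p.1 : 𝒜) + (p.2 : 𝒜) ∧ P x = p.1 := fun x hx => by
    refine ⟨e.symm (R' x), ?_, rfl⟩
    have h1 : ((e (e.symm (R' x)) : f.range) : 𝒜) = R x := by rw [e.apply_symm_apply]; rfl
    rw [hRx x hx] at h1
    exact h1.symm
  refine ⟨P, fun x => Subtype.prop _, fun x hx => ?_, fun x hx h hh => ?_⟩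
  · have hxsa : IsSelfAdjoint x := (hrange x).1 ⟨(⟨x, hx⟩, 0), by simp [hf]⟩
    obtain ⟨p, h1, h2⟩ := hdecomp x hxsa
    have h3 : f p = f (⟨x, hx⟩, 0) := by rw [hf, ← h1]; simp [hf]
    rw [h2, hinj h3]
  · obtain ⟨p, h1, h2⟩ := hdecomp x hx
    have h3 : x - P x = p.2 := by rw [h2]; nth_rewrite 1 [h1]; simp
    rw [h3]
    exact horth h hh _ p.2.2

variable {H : Submodule ℝ 𝒜}

lemma coshAd_mem_of_mem (hclosed : IsClosed (H : Set 𝒜))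
    (hbracket : ∀ x ∈ H, ∀ y ∈ H, ⁅x, ⁅x, y⁆⁆ ∈ H) {X h : 𝒜} (hX : X ∈ H) (hh : h ∈ H) :
    coshAd X h ∈ H :=
  coshAd_mem hclosed (fun k hk => hbracket X hX k hk) hh

/-- The translated derivative of the exponential at a point of `H` maps `H` onto `H`. -/
lemma IsFaithfulTrace.inverse_ndexp_mem (hτ : IsFaithfulTrace τ) (hsa : ∀ x ∈ H, IsSelfAdjoint x)
    (hclosed : IsClosed (H : Set 𝒜)) (hsupp : HasOrthogonalSupplement τ H)
    (hbracket : ∀ x ∈ H, ∀ y ∈ H, ⁅x, ⁅x, y⁆⁆ ∈ H) {X g : 𝒜} (hX : X ∈ H) (hg : g ∈ H) :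
    Ring.inverse (ndexp X) g ∈ H := by
  obtain ⟨P, hPH, hPid, hPorth⟩ := exists_projection hclosed hsupp
  have hu := isUnit_ndexp (hsa X hX)
  have hinj := (ContinuousLinearMap.isUnit_iff_bijective.1 hu).1
  set u := Ring.inverse (ndexp X) g with hudef
  have hug : ndexp X u = g := by
    rw [hudef, ← mul_apply_eq_comp, Ring.mul_inverse_cancel _ hu, one_apply_eq_self]
  have husa : IsSelfAdjoint u := by
    refine hinj ?_
    have h1 := (IsSelfAdjoint.exp (isSelfAdjoint_smul (hsa X hX) (-1 / 2))).star_eq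
    have h2 := (hsa g hg).star_eq
    rw [← hug, ndexp_apply, star_mul, star_mul, h1, star_dexp (hsa X hX), ← mul_assoc] at h2
    rw [ndexp_apply, h2, ndexp_apply]
  -- `W` is the orthogonal complement of `H` among selfadjoint elements. Symmetry of the cosine
  -- makes `W` invariant along with `H`, so the image of `u - P u` lies in both and vanishes.
  let W : Submodule ℝ 𝒜 :=
    { carrier := {s | IsSelfAdjoint s ∧ ∀ h ∈ H, ip τ s h = 0}
      add_mem' := fun {a b} ha hb => ⟨ha.1.add hb.1, fun h hh => by
        rw [ip_add_left, ha.2 h hh, hb.2 h hh, add_zero]⟩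
      zero_mem' := ⟨IsSelfAdjoint.zero 𝒜, fun h _ => by simp [ip]⟩
      smul_mem' := fun c a ha => ⟨isSelfAdjoint_smul ha.1 c, fun h hh => by
        rw [ip_smul_left, ha.2 h hh, mul_zero]⟩ }
  have hW : ∀ s, s ∈ W ↔ IsSelfAdjoint s ∧ ∀ h ∈ H, ip τ s h = 0 := fun s => Iff.rfl
  have hWc : IsClosed (W : Set 𝒜) := by
    have : (W : Set 𝒜) = {s | star s = s} ∩ ⋂ h ∈ H, {s | ip τ s h = 0} := by
      ext s; simp [hW, IsSelfAdjoint]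
    rw [this]
    refine (isClosed_eq continuous_star continuous_id).inter
      (isClosed_biInter fun h _ => isClosed_eq ?_ continuous_const)
    have := hτ.continuous
    unfold ip
    fun_prop
  have hWcosh : ∀ t : ℝ, ∀ s ∈ W, coshAd (t • X) s ∈ W := fun t s hs =>
    ⟨isSelfAdjoint_coshAd (isSelfAdjoint_smul (hsa X hX) t) hs.1, fun h hh => by
      rw [hτ.ip_coshAd]
      exact hs.2 _ (coshAd_mem_of_mem hclosed hbracket (H.smul_mem t hX) hh)⟩
  have hs : u - P u ∈ W := ⟨husa.sub (hsa _ (hPH u)), fun h hh => by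
    rw [hτ.ip_comm, ip, hPorth u husa h hh, Complex.zero_re]⟩
  have h1 : ndexp X (u - P u) ∈ W := ndexp_mem_of_coshAd_mem hWc hWcosh hs
  have h2 : ndexp X (u - P u) ∈ H := by
    rw [map_sub, hug]
    exact H.sub_mem hg (ndexp_mem_of_coshAd_mem hclosed
      (fun t h hh => coshAd_mem_of_mem hclosed hbracket (H.smul_mem t hX) hh) (hPH u))
  have h3 : ndexp X (u - P u) = 0 := hτ.eq_zero_of_nrm_eq_zero <| by
    rw [← sq_eq_zero_iff, hτ.nrm_sq_of_isSelfAdjoint h1.1, h1.2 _ h2]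
  have h4 : u - P u = 0 := hinj (by rw [h3, map_zero])
  rw [sub_eq_zero.1 h4]
  exact hPH u

/-- The vector field of the curve `t ↦ log (e^{ty} a e^{ty})`. -/
noncomputable def logField (y X : 𝒜) : 𝒜 :=
  Ring.inverse (ndexp X) ((2 : ℝ) • coshAd ((1 / 2 : ℝ) • X) y)

/-- Continuous differentiability supplies the local Lipschitz bound needed for the Grönwall
argument. -/
lemma contDiffAt_logField {y X : 𝒜} (hX : IsSelfAdjoint X) : ContDiffAt ℝ 1 (logField y) X := by
  have h1 : ContDiff ℝ 1 (exp : 𝒜 → 𝒜) := contDiff_exp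
  have h2 : ContDiff ℝ 1 (dexp : 𝒜 → 𝒜 →L[ℝ] 𝒜) :=
    (contDiff_exp (n := 2)).fderiv_right (by norm_num)
  have h3 : ContDiff ℝ 1 (ndexp : 𝒜 → 𝒜 →L[ℝ] 𝒜) := by
    have e1 : ContDiff ℝ 1 fun X : 𝒜 => exp ((-1 / 2 : ℝ) • X) := by fun_prop
    have e0 : ContDiff ℝ 1 fun a : 𝒜 => ContinuousLinearMap.mulLeftRight ℝ 𝒜 a := by fun_prop
    have e2 : ContDiff ℝ 1 fun X : 𝒜 => ContinuousLinearMap.mulLeftRight ℝ 𝒜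
        (exp ((-1 / 2 : ℝ) • X)) := 
      e0.comp e1
    exact (e2.clm_apply e1).clm_comp h2
  have h4 : ContDiff ℝ 1 fun X : 𝒜 => (2 : ℝ) • coshAd ((1 / 2 : ℝ) • X) y := by
    simp only [coshAd_apply]
    fun_prop
  obtain ⟨u, hu⟩ := isUnit_ndexp hX
  have h5 : ContDiffAt ℝ 1 (fun X : 𝒜 => Ring.inverse (ndexp X)) X := by
    have h6 := contDiffAt_ringInverse ℝ (n := 1) u
    rw [hu] at h6
    exact h6.comp X h3.contDiffAt
  exact h5.clm_apply h4.contDiffAt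

lemma logField_eq {X y u : 𝒜} (hX : IsSelfAdjoint X) (h : dexp X u = y * exp X + exp X * y) :
    u = logField y X := by
  have e1 : exp X = exp ((1 / 2 : ℝ) • X) * exp ((1 / 2 : ℝ) • X) := exp_eq_half_mul_half X
  have e2 : (-1 / 2 : ℝ) • X = -((1 / 2 : ℝ) • X) := by rw [← neg_smul]; norm_num
  have h1 : ndexp X u = (2 : ℝ) • coshAd ((1 / 2 : ℝ) • X) y := by
    rw [ndexp_apply, h, e1, e2, coshAd_apply, smul_smul]
    simp only [mul_add, add_mul, mul_assoc, exp_neg_mul_exp_mul, exp_mul_exp_neg, mul_one]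
    norm_num
  rw [logField, ← h1, ← mul_apply_eq_comp, Ring.inverse_mul_cancel _ (isUnit_ndexp hX),
    one_apply_eq_self]

/-- The exponential of a Lie triple system is closed under the congruences by its elements. -/
lemma IsFaithfulTrace.exp_congr_mem (hτ : IsFaithfulTrace τ) (hsa : ∀ x ∈ H, IsSelfAdjoint x)
    (hclosed : IsClosed (H : Set 𝒜)) (hsupp : HasOrthogonalSupplement τ H)
    (hbracket : ∀ x ∈ H, ∀ y ∈ H, ⁅x, ⁅x, y⁆⁆ ∈ H) {x y : 𝒜} (hx : x ∈ H) (hy : y ∈ H) :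
    ∃ v ∈ H, exp y * exp x * exp y = exp v := by
  obtain ⟨P, hPH, hPid, -⟩ := exists_projection hclosed hsupp
  set p : ℝ → 𝒜 := fun t => exp (t • y) * exp x * exp (t • y) with hp
  have hpcone : ∀ t ∈ (univ : Set ℝ), p t ∈ posCone 𝒜 := fun t _ =>
    exp_congr_mem_posCone (isSelfAdjoint_smul (hsa y hy) t) (exp_mem_posCone (hsa x hx))
  set X : ℝ → 𝒜 := fun t => CFC.log (p t) with hX
  have hXsa : ∀ t, IsSelfAdjoint (X t) := fun t => IsSelfAdjoint.log
  have hpX : ∀ t, exp (X t) = p t := fun t => exp_log_of_mem_posCone (hpcone t trivial)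
  have hpd : ∀ t, HasDerivAt p (y * p t + p t * y) t := fun t => by
    refine (((hasDerivAt_exp_smul y t).mul_const (exp x)).fun_mul
      (hasDerivAt_exp_smul y t)).congr_deriv ?_
    have hc : y * exp (t • y) = exp (t • y) * y :=
      (((Commute.refl y).smul_right t).exp_right).eq
    rw [hp]
    simp only [← mul_assoc, hc]
  have hXd : ∀ t, HasDerivAt X (logField y (X t)) t := fun t => by
    obtain ⟨u, hu, hu'⟩ := exists_hasDerivWithinAt_log (hpd t).hasDerivWithinAt hpcone
      (mem_univ t)
    rw [hasDerivWithinAt_univ] at hu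
    have : u = logField y (X t) := logField_eq (hXsa t) (by rw [hpX]; exact hu')
    rwa [← this]
  have hXc : Continuous X := continuous_iff_continuousAt.2 fun t => (hXd t).continuousAt
  have hfield : ∀ Z ∈ H, logField y Z ∈ H := fun Z hZ =>
    hτ.inverse_ndexp_mem hsa hclosed hsupp hbracket hZ
      (H.smul_mem _ (coshAd_mem_of_mem hclosed hbracket (H.smul_mem _ hZ) hy))
  -- Continuous induction: the set of times with `X t ∈ H` is closed, contains `0`, and extends to
  -- the right of each of its points.
  have hsub : Icc (0 : ℝ) 1 ⊆ X ⁻¹' (H : Set 𝒜) := by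
    refine IsClosed.Icc_subset_of_forall_mem_nhdsWithin
      ((hclosed.preimage hXc).inter isClosed_Icc) ?_ ?_
    · simp [hX, hp, CFC.log_exp x (hsa x hx), hx]
    rintro t₀ ⟨ht₀, -⟩
    obtain ⟨K, U, hU, hK⟩ := (contDiffAt_logField (y := y) (hXsa t₀)).exists_lipschitzOnWith
    have hPX : Tendsto (fun t => P (X t)) (𝓝 t₀) (𝓝 (X t₀)) := by
      have := (P.continuous.comp hXc).tendsto t₀
      rwa [Function.comp_apply, hPid _ ht₀] at this
    have hev : ∀ᶠ t in 𝓝 t₀, X t ∈ U ∧ P (X t) ∈ U :=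
      ((hXc.tendsto t₀).eventually hU).and (hPX.eventually hU)
    obtain ⟨δ, hδ, hball⟩ := Metric.eventually_nhds_iff.1 hev
    have hzero := eq_zero_of_abs_deriv_le_mul_abs_self_of_eq_zero_right
      (f := fun t => X t - P (X t)) (f' := fun t => logField y (X t) - P (logField y (X t)))
      (a := t₀) (b := t₀ + δ / 2) (K := ‖ContinuousLinearMap.id ℝ 𝒜 - P‖ * K)
      (hXc.sub (P.continuous.comp hXc)).continuousOn
      (fun t _ => ((hXd t).sub (P.hasFDerivAt.comp_hasDerivAt t (hXd t))).hasDerivWithinAt)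
      (by simp [hPid _ ht₀])
      (fun t ht => by
        have htU := hball (show dist t t₀ < δ by
          rw [Real.dist_eq, abs_of_nonneg (by linarith [ht.1])]; linarith [ht.2])
        -- The field maps `H` to `H`, so `1 - P` kills its value at `P (X t)`. Subtracting that
        -- value bounds the derivative of `X - P X` by a multiple of `‖X - P X‖`.
        have h1 : logField y (X t) - P (logField y (X t)) =
            (ContinuousLinearMap.id ℝ 𝒜 - P) (logField y (X t) - logField y (P (X t))) := by
          have h2 := hPid _ (hfield _ (hPH (X t)))
          simp [h2]
        rw [h1, mul_assoc]
        refine (ContinuousLinearMap.le_opNorm _ _).trans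
          (mul_le_mul_of_nonneg_left ?_ (norm_nonneg _))
        simpa [dist_eq_norm] using hK.dist_le_mul _ htU.1 _ htU.2)
    refine mem_of_superset (Ioc_mem_nhdsGT (show t₀ < t₀ + δ / 2 by linarith)) fun t ht => ?_
    have h1 := sub_eq_zero.1 (hzero t (Ioc_subset_Icc_self ht))
    change X t ∈ H
    rw [h1]
    exact hPH _
  refine ⟨X 1, hsub (by simp), ?_⟩
  rw [hpX]
  simp [hp]

end LieTriple
end FiniteVN

namespace FiniteVN

open NormedSpace Filter Topology

/-! ### Trace-norm completeness of operator-norm balls -/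

section VonNeumann

variable {K : Type*} [NormedAddCommGroup K] [InnerProductSpace ℂ K] [CompleteSpace K]

/-- Bounded families of operators converge weakly along ultrafilters. -/
lemma exists_weak_limit {ι : Type*} (U : Ultrafilter ι) (y : ι → K →L[ℂ] K) {ρ : ℝ}
    (hρ : ∀ n, ‖y n‖ ≤ ρ) :
    ∃ T : K →L[ℂ] K, ‖T‖ ≤ ρ ∧ ∀ v w, Tendsto (fun n => ⟪w, y n v⟫_ℂ) U (𝓝 ⟪w, T v⟫_ℂ) := by
  obtain ⟨n₀⟩ : Nonempty ι := (U : Filter ι).nonempty_of_neBot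
  have hρ0 : 0 ≤ ρ := (norm_nonneg _).trans (hρ n₀)
  have hbound : ∀ v w n, ‖⟪y n v, w⟫_ℂ‖ ≤ ρ * ‖v‖ * ‖w‖ := fun v w n =>
    (norm_inner_le_norm _ _).trans
      (mul_le_mul_of_nonneg_right ((y n).le_of_opNorm_le (hρ n) v) (norm_nonneg _))
  -- Each matrix coefficient stays in a compact disc. One ultrafilter serves all pairs of vectors at
  -- once, so no separability is needed.
  have hlim : ∀ v w, ∃ b ∈ Metric.closedBall (0 : ℂ) (ρ * ‖v‖ * ‖w‖),
      Tendsto (fun n => ⟪y n v, w⟫_ℂ) U (𝓝 b) := fun v w =>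
    (isCompact_closedBall (0 : ℂ) (ρ * ‖v‖ * ‖w‖)).ultrafilter_le_nhds'
      (U.map fun n => ⟪y n v, w⟫_ℂ) (Ultrafilter.mem_map.2 (univ_mem' fun n => by
        simpa using hbound v w n))
  choose b hb hb' using hlim
  let B₀ : K →ₗ⋆[ℂ] K →ₗ[ℂ] ℂ := LinearMap.mk₂'ₛₗ (starRingEnd ℂ) (RingHom.id ℂ) b
    (fun v v' w => tendsto_nhds_unique (hb' _ _) (by
      simpa [inner_add_left] using (hb' v w).add (hb' v' w)))
    (fun c v w => tendsto_nhds_unique (hb' _ _) (by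
      simpa [inner_smul_left, mul_comm] using (hb' v w).const_mul (starRingEnd ℂ c)))
    (fun v w w' => tendsto_nhds_unique (hb' _ _) (by
      simpa [inner_add_right] using (hb' v w).add (hb' v w')))
    (fun c v w => tendsto_nhds_unique (hb' _ _) (by
      simpa [inner_smul_right] using (hb' v w).const_mul c))
  let B : K →L⋆[ℂ] K →L[ℂ] ℂ := B₀.mkContinuous₂ ρ fun v w => by
    change ‖b v w‖ ≤ _
    simpa using hb v w
  let T := InnerProductSpace.continuousLinearMapOfBilin B
  have hT : ∀ v w, ⟪T v, w⟫_ℂ = b v w := fun v w =>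
    InnerProductSpace.continuousLinearMapOfBilin_apply B v w
  refine ⟨T, T.opNorm_le_bound hρ0 fun v => ?_, fun v w => ?_⟩
  · have h1 := hb v (T v)
    rw [← hT, mem_closedBall_zero_iff, inner_self_eq_norm_sq_to_K, norm_pow, RCLike.norm_ofReal,
      abs_norm] at h1
    nlinarith [norm_nonneg (T v), mul_nonneg hρ0 (norm_nonneg v)]
  · have h1 := (Complex.continuous_conj.tendsto _).comp (hb' v w)
    rw [← hT, inner_conj_symm] at h1
    simpa [Function.comp_def, inner_conj_symm] using h1

/-- By the double commutant property it suffices to commute with the commutant, and commutation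
passes to weak limits after moving one factor to the other side as an adjoint. -/
lemma mem_of_weak_limit {ι : Type*} (A : VonNeumannAlgebra K) (U : Filter ι) [U.NeBot]
    {y : ι → K →L[ℂ] K} (hy : ∀ n, y n ∈ A) {T : K →L[ℂ] K}
    (hT : ∀ v w, Tendsto (fun n => ⟪w, y n v⟫_ℂ) U (𝓝 ⟪w, T v⟫_ℂ)) : T ∈ A := by
  rw [← A.commutant_commutant, VonNeumannAlgebra.mem_commutant_iff]
  intro g hg
  rw [VonNeumannAlgebra.mem_commutant_iff] at hg
  ext v
  refine ext_inner_left ℂ fun w => ?_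
  have h1 := hT v (ContinuousLinearMap.adjoint g w)
  have h2 := hT (g v) w
  have h3 : ∀ n, ⟪ContinuousLinearMap.adjoint g w, y n v⟫_ℂ = ⟪w, y n (g v)⟫_ℂ := fun n => by
    rw [ContinuousLinearMap.adjoint_inner_left]
    exact congrArg (fun z : K →L[ℂ] K => ⟪w, z v⟫_ℂ) (hg (y n) (hy n)).symm
  simp only [h3] at h1
  rw [mul_apply_eq_comp, mul_apply_eq_comp, ← ContinuousLinearMap.adjoint_inner_left]
  exact tendsto_nhds_unique h1 h2

variable {A : VonNeumannAlgebra K} {τ : A.toStarSubalgebra →ₗ[ℂ] ℂ}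

lemma IsFiniteTrace.isFaithfulTrace (hτ : IsFiniteTrace A τ) : IsFaithfulTrace τ :=
  ⟨hτ.nonneg, hτ.tracial, hτ.faithful⟩

/-- A normal functional is weakly continuous on bounded sets. -/
lemma IsFiniteTrace.tendsto_of_weak {ι : Type*} {U : Filter ι} (hτ : IsFiniteTrace A τ)
    {y : ι → A.toStarSubalgebra} {T : A.toStarSubalgebra} {R : ℝ} (hR : ∀ n, ‖y n‖ ≤ R)
    (hT : ∀ v w : K, Tendsto (fun n => ⟪w, (y n : K →L[ℂ] K) v⟫_ℂ) U
      (𝓝 ⟪w, (T : K →L[ℂ] K) v⟫_ℂ)) :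
    Tendsto (fun n => τ (y n)) U (𝓝 (τ T)) := by
  obtain ⟨ξ, η, hξ, hη, h⟩ := hτ.normal
  simp only [← (h _).tsum_eq]
  refine tendsto_tsum_of_dominated_convergence
    (bound := fun k => R * (‖ξ k‖ ^ 2 + ‖η k‖ ^ 2)) ((hξ.add hη).mul_left R)
    (fun k => hT (ξ k) (η k)) (Eventually.of_forall fun n k => ?_)
  have hR0 : 0 ≤ R := (norm_nonneg _).trans (hR n)
  have h1 : ‖(y n : K →L[ℂ] K) (ξ k)‖ ≤ R * ‖ξ k‖ := ContinuousLinearMap.le_of_opNorm_le _ (hR n) _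
  calc ‖⟪η k, (y n : K →L[ℂ] K) (ξ k)⟫_ℂ‖ ≤ ‖η k‖ * ‖(y n : K →L[ℂ] K) (ξ k)‖ :=
        norm_inner_le_norm _ _
    _ ≤ ‖η k‖ * (R * ‖ξ k‖) := mul_le_mul_of_nonneg_left h1 (norm_nonneg _)
    _ = R * (‖ξ k‖ * ‖η k‖) := by ring
    _ ≤ R * (‖ξ k‖ ^ 2 + ‖η k‖ ^ 2) := by
      refine mul_le_mul_of_nonneg_left ?_ hR0
      nlinarith [sq_nonneg (‖ξ k‖ - ‖η k‖), sq_nonneg ‖ξ k‖, sq_nonneg ‖η k‖]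

/-- The balls of a von Neumann algebra are complete for the norm of a finite trace. -/
lemma IsFiniteTrace.exists_limit (hτ : IsFiniteTrace A τ) {y : ℕ → A.toStarSubalgebra} {ρ : ℝ}
    (hρ : ∀ n, ‖y n‖ ≤ ρ)
    (hy : ∀ ε > 0, ∃ N, ∀ m ≥ N, ∀ n ≥ N, nrm τ (y n - y m) ≤ ε) :
    ∃ x : A.toStarSubalgebra, ‖x‖ ≤ ρ ∧ Tendsto (fun n => nrm τ (y n - x)) atTop (𝓝 0) := by
  have hτ' := hτ.isFaithfulTrace
  let U : Ultrafilter ℕ := hyperfilter ℕ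
  have hU : (U : Filter ℕ) ≤ atTop := by
    rw [← Nat.cofinite_eq_atTop]; exact hyperfilter_le_cofinite
  obtain ⟨T, hTρ, hT⟩ := exists_weak_limit U (fun n => (y n : K →L[ℂ] K)) hρ
  have hTA : T ∈ A := mem_of_weak_limit A (U : Filter ℕ) (fun n => (y n).2) hT
  let x : A.toStarSubalgebra := ⟨T, hTA⟩
  refine ⟨x, hTρ, ?_⟩
  rw [Metric.tendsto_atTop]
  intro ε hε
  obtain ⟨N, hN⟩ := hy (ε / 2) (half_pos hε)
  refine ⟨N, fun n hn => ?_⟩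
  rw [dist_zero_right, Real.norm_of_nonneg (nrm_nonneg _)]
  -- Testing against `c` turns weak convergence in `m` into `‖y n - x‖₂² ≤ ‖y n - x‖₂ · ε/2`; the
  -- Cauchy condition then forces convergence of the full sequence, not only along the ultrafilter.
  set c := star (y n - x) with hc
  have hlim : Tendsto (fun m => τ (c * (y n - y m))) U (𝓝 (τ (c * (y n - x)))) := by
    refine hτ.tendsto_of_weak (R := ‖c‖ * (ρ + ρ)) (fun m => ?_) (fun v w => ?_)
    · refine (norm_mul_le _ _).trans (mul_le_mul_of_nonneg_left ?_ (norm_nonneg _))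
      exact (norm_sub_le _ _).trans (add_le_add (hρ n) (hρ m))
    · have h1 := (hT v (ContinuousLinearMap.adjoint (c : K →L[ℂ] K) w)).const_sub
        ⟪ContinuousLinearMap.adjoint (c : K →L[ℂ] K) w, (y n : K →L[ℂ] K) v⟫_ℂ
      simp only [← inner_sub_right] at h1
      simp only [ContinuousLinearMap.adjoint_inner_left] at h1
      exact h1
  have h1 : ‖τ (c * (y n - x))‖ ≤ nrm τ c * (ε / 2) := by
    refine le_of_tendsto hlim.norm ?_
    filter_upwards [hU (eventually_ge_atTop N)] with m hm
    exact (hτ'.norm_map_mul_le _ _).trans (mul_le_mul_of_nonneg_left (hN m hm n hn) (nrm_nonneg _))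
  have h2 : nrm τ (y n - x) ^ 2 ≤ nrm τ (y n - x) * (ε / 2) := by
    rw [hc, hτ'.nrm_star] at h1
    rw [hτ'.nrm_sq]
    exact (Complex.re_le_norm _).trans h1
  nlinarith [nrm_nonneg (τ := τ) (y n - x)]

end VonNeumann
end FiniteVN

namespace FiniteVN

open NormedSpace Filter Topology

/-! ### Factorizations, nearest points and uniqueness -/

section Factorization

universe u

variable {𝒜 : Type u} [CStarAlgebra 𝒜] {τ : 𝒜 →ₗ[ℂ] ℂ}

/-- The element `w` with `e^z = e^y e^w e^y`. -/
noncomputable def logCongr (z y : 𝒜) : 𝒜 := CFC.log (exp (-y) * exp z * exp (-y))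

lemma isSelfAdjoint_logCongr (z y : 𝒜) : IsSelfAdjoint (logCongr z y) := IsSelfAdjoint.log

lemma exp_congr_injective {y a b : 𝒜} (h : exp y * a * exp y = exp y * b * exp y) : a = b := by
  have h1 := congrArg (fun c => exp (-y) * c * exp (-y)) h
  simpa only [mul_assoc, exp_neg_mul_exp_mul, exp_mul_exp_neg, mul_one] using h1

lemma exp_congr_neg (y a : 𝒜) : exp y * (exp (-y) * a * exp (-y)) * exp y = a := by
  simp only [mul_assoc, exp_neg_mul_exp, exp_mul_exp_neg_mul, mul_one]

lemma exp_logCongr {z y : 𝒜} (hz : IsSelfAdjoint z) (hy : IsSelfAdjoint y) :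
    exp (logCongr z y) = exp (-y) * exp z * exp (-y) :=
  exp_log_of_mem_posCone (exp_congr_mem_posCone hy.neg (exp_mem_posCone hz))

lemma exp_eq_congr_logCongr {z y : 𝒜} (hz : IsSelfAdjoint z) (hy : IsSelfAdjoint y) :
    exp z = exp y * exp (logCongr z y) * exp y := by
  rw [exp_logCongr hz hy, exp_congr_neg]

lemma norm_logCongr_le {z y : 𝒜} (hz : IsSelfAdjoint z) (hy : IsSelfAdjoint y) :
    ‖logCongr z y‖ ≤ ‖z‖ + 2 * ‖y‖ := by
  have h := norm_log_congr_add_le (isSelfAdjoint_logCongr z y) hy hz (exp_logCongr hz hy)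
  have h2 := norm_sub_le (logCongr z y + (2 : ℝ) • y) ((2 : ℝ) • y)
  rw [add_sub_cancel_right, norm_smul] at h2
  norm_num at h2
  linarith

namespace IsFaithfulTrace

variable (hτ : IsFaithfulTrace τ)
include hτ

lemma nrm_sub_sq {x y : 𝒜} (hx : IsSelfAdjoint x) (hy : IsSelfAdjoint y) :
    nrm τ (x - y) ^ 2 = nrm τ x ^ 2 - 2 * ip τ x y + nrm τ y ^ 2 := by
  rw [hτ.nrm_sq_of_isSelfAdjoint (hx.sub hy), hτ.nrm_sq_of_isSelfAdjoint hx,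
    hτ.nrm_sq_of_isSelfAdjoint hy, ip_sub_left, ip_sub_right, ip_sub_right, hτ.ip_comm y x]
  ring

lemma geodesicDist_congr_exp {w x y : 𝒜} (hw : IsSelfAdjoint w) (hx : IsSelfAdjoint x)
    (hy : IsSelfAdjoint y) :
    geodesicDist τ (exp y * exp w * exp y) (exp y * exp x * exp y) =
      geodesicDist τ (exp w) (exp x) :=
  hτ.geodesicDist_congr hy (exp_mem_posCone hw) (exp_mem_posCone hx)

lemma geodesicDist_congr_one {w y : 𝒜} (hw : IsSelfAdjoint w) (hy : IsSelfAdjoint y) :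
    geodesicDist τ (exp y * exp w * exp y) (exp ((2 : ℝ) • y)) = nrm τ w := by
  have h := hτ.geodesicDist_congr_exp hw (IsSelfAdjoint.zero 𝒜) hy
  rwa [exp_zero, mul_one, ← exp_two_smul, hτ.geodesicDist_exp_one hw] at h

/-- The left side is `dist(e^z, e^{2y'})`; the congruence by `e^{-y}` moves the base point `e^{2y}`
to `1`. -/
lemma nrm_logCongr_eq {z y y' x : 𝒜} (hz : IsSelfAdjoint z) (hy : IsSelfAdjoint y)
    (hy' : IsSelfAdjoint y') (hx : IsSelfAdjoint x)
    (h : exp ((2 : ℝ) • y') = exp y * exp x * exp y) :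
    nrm τ (logCongr z y') = geodesicDist τ (exp (logCongr z y)) (exp x) := by
  have h1 := hτ.geodesicDist_congr_one (isSelfAdjoint_logCongr z y') hy'
  rw [← exp_eq_congr_logCongr hz hy', h, exp_eq_congr_logCongr hz hy,
    hτ.geodesicDist_congr_exp (isSelfAdjoint_logCongr z y) hx hy] at h1
  exact h1.symm

/-- On the spectrum, `t(e^t - 1) ≥ e^{-‖x‖} t²`. Take traces in the functional calculus and apply
Cauchy–Schwarz. -/
lemma nrm_le_nrm_exp_sub_one {x : 𝒜} (hx : IsSelfAdjoint x) :
    nrm τ x ≤ Real.exp ‖x‖ * nrm τ (exp x - 1) := by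
  let := CStarAlgebra.spectralOrder 𝒜
  have := CStarAlgebra.spectralOrderedRing 𝒜
  rcases subsingleton_or_nontrivial 𝒜 with hsub | hsub
  · rw [Subsingleton.elim x 0]
    simp [nrm]
  have h1 : 0 ≤ cfc (fun t : ℝ => t * (Real.exp t - 1) - Real.exp (-‖x‖) * (t * t)) x := by
    refine cfc_nonneg fun t ht => ?_
    have ht' : |t| ≤ ‖x‖ := spectrum.norm_le_norm_of_mem ht
    have e1 := Real.add_one_le_exp t
    have e2 := Real.add_one_le_exp (-t)
    have e3 : Real.exp t * Real.exp (-t) = 1 := by rw [← Real.exp_add]; simp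
    have e4 : Real.exp (-‖x‖) ≤ Real.exp t := Real.exp_le_exp.2 (by linarith [(abs_le.1 ht').1])
    have e5 : Real.exp (-‖x‖) ≤ 1 := Real.exp_le_one_iff.2 (by simp)
    rcases le_total 0 t with h0 | h0
    · nlinarith [mul_nonneg h0 h0, mul_le_mul_of_nonneg_left e1 h0]
    · have e6 : Real.exp t * (1 - t) ≤ 1 := by
        rw [← e3]; exact mul_le_mul_of_nonneg_left (by linarith) (Real.exp_pos t).le
      nlinarith [mul_nonneg_of_nonpos_of_nonpos h0 h0, Real.exp_pos t]
  have h2 : cfc (fun t : ℝ => t * (Real.exp t - 1) - Real.exp (-‖x‖) * (t * t)) x =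
      x * (exp x - 1) - Real.exp (-‖x‖) • (x * x) := by
    rw [cfc_sub .., cfc_mul .., cfc_sub .., cfc_const_mul .., cfc_mul .., cfc_id' ℝ x,
      cfc_const_one ℝ x, CFC.real_exp_eq_normedSpace_exp hx]
  rw [h2] at h1
  obtain ⟨v, hv⟩ := CStarAlgebra.nonneg_iff_eq_star_mul_self.1 h1
  have h3 := (Complex.nonneg_iff.1 (hτ.nonneg v)).1
  rw [← hv, map_sub, Complex.sub_re] at h3
  have h4 : (τ (Real.exp (-‖x‖) • (x * x))).re = Real.exp (-‖x‖) * nrm τ x ^ 2 := by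
    rw [hτ.nrm_sq_of_isSelfAdjoint hx, ← ip_smul_left, ip, smul_mul_assoc]
  rw [h4] at h3
  have h5 : Real.exp (-‖x‖) * nrm τ x ^ 2 ≤ nrm τ x * nrm τ (exp x - 1) :=
    (sub_nonneg.1 h3).trans ((le_abs_self _).trans (hτ.abs_ip_le x (exp x - 1)))
  have h6 : Real.exp ‖x‖ * Real.exp (-‖x‖) = 1 := by rw [← Real.exp_add]; simp
  rcases (nrm_nonneg (τ := τ) x).eq_or_lt with h0 | h0
  · rw [← h0]; exact mul_nonneg (Real.exp_pos _).le (nrm_nonneg _)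
  · have h7 : Real.exp (-‖x‖) * nrm τ x ≤ nrm τ (exp x - 1) := by nlinarith
    calc nrm τ x = Real.exp ‖x‖ * (Real.exp (-‖x‖) * nrm τ x) := by rw [← mul_assoc, h6, one_mul]
      _ ≤ _ := mul_le_mul_of_nonneg_left h7 (Real.exp_pos _).le

variable {H : Submodule ℝ 𝒜} (hsa : ∀ x ∈ H, IsSelfAdjoint x)
include hsa

/-- A trace-norm limit of elements of `H` lies in `H`. -/
lemma mem_of_tendsto_nrm {P : 𝒜 →L[ℝ] 𝒜} (hPH : ∀ x, P x ∈ H)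
    (hP : ∀ x, IsSelfAdjoint x → ∀ h ∈ H, τ (h * (x - P x)) = 0) {y : ℕ → 𝒜} {x : 𝒜}
    (hy : ∀ n, y n ∈ H) (hlim : Tendsto (fun n => nrm τ (y n - x)) atTop (𝓝 0)) : x ∈ H := by
  have hxsa : IsSelfAdjoint x := by
    have h1 : ∀ n, nrm τ (star x - x) ≤ nrm τ (y n - x) + nrm τ (y n - x) := fun n => by
      have h2 : star x - x = -star (y n - x) + (y n - x) := by
        rw [star_sub, (hsa _ (hy n)).star_eq]; abel
      rw [h2]
      refine (hτ.nrm_add_le _ _).trans_eq ?_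
      rw [nrm_neg, hτ.nrm_star]
    have h3 := ge_of_tendsto' (hlim.add hlim) h1
    rw [add_zero] at h3
    exact sub_eq_zero.1 (hτ.eq_zero_of_nrm_eq_zero (h3.antisymm (nrm_nonneg _)))
  set σ := x - P x with hσ
  have hσsa : IsSelfAdjoint σ := hxsa.sub (hsa _ (hPH x))
  have horth : ∀ h ∈ H, ip τ σ h = 0 := fun h hh => by
    rw [hτ.ip_comm, ip, hP x hxsa h hh, Complex.zero_re]
  -- As `σ` is orthogonal to `P x` and to `y n`, `‖σ‖₂² = -⟨σ, y n - x⟩`.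
  have h1 : ∀ n, nrm τ σ ^ 2 ≤ nrm τ σ * nrm τ (y n - x) := fun n => by
    have h2 : ip τ σ σ = -ip τ σ (y n - x) := by
      nth_rewrite 2 [hσ]
      rw [ip_sub_right, ip_sub_right, horth _ (hPH x), horth _ (hy n)]
      ring
    rw [hτ.nrm_sq_of_isSelfAdjoint hσsa, h2]
    exact (neg_le_abs _).trans (hτ.abs_ip_le _ _)
  have h2 := ge_of_tendsto' (hlim.const_mul (nrm τ σ)) h1
  rw [mul_zero] at h2
  have h3 : nrm τ σ = 0 := pow_eq_zero_iff two_ne_zero |>.1 (h2.antisymm (sq_nonneg _))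
  rw [sub_eq_zero.1 (hτ.eq_zero_of_nrm_eq_zero h3)]
  exact hPH x

/-- A factorization determines the nearest point. -/
lemma nearest_of_isFactorization (hclosed : IsClosed (H : Set 𝒜))
    (hsupp : HasOrthogonalSupplement τ H) (hbracket : ∀ x ∈ H, ∀ y ∈ H, ⁅x, ⁅x, y⁆⁆ ∈ H)
    {z y w : 𝒜} (h : IsFactorization τ H z y w) :
    IsNearestPoint τ (exp '' (H : Set 𝒜)) (exp z) (exp ((2 : ℝ) • y)) ∧
      ∀ p, IsNearestPoint τ (exp '' (H : Set 𝒜)) (exp z) p → p = exp ((2 : ℝ) • y) := by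
  have hy := hsa y h.mem
  have hw := h.selfAdjoint
  have hd : geodesicDist τ (exp z) (exp ((2 : ℝ) • y)) = nrm τ w := by
    rw [h.exp_eq, hτ.geodesicDist_congr_one hw hy]
  have key : ∀ q ∈ H, ∃ x ∈ H, exp q = exp y * exp x * exp y ∧
      nrm τ w ^ 2 + nrm τ x ^ 2 ≤ geodesicDist τ (exp z) (exp q) ^ 2 := fun q hq => by
    obtain ⟨x, hx, hqx⟩ :=
      hτ.exp_congr_mem hsa hclosed hsupp hbracket hq (H.neg_mem h.mem)
    have hqx' : exp q = exp y * exp x * exp y := by rw [← hqx, exp_congr_neg]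
    refine ⟨x, hx, hqx', ?_⟩
    have h1 := hτ.nrm_sub_le_geodesicDist hw (hsa x hx)
    rw [← hτ.geodesicDist_congr_exp hw (hsa x hx) hy, ← hqx', ← h.exp_eq] at h1
    have h2 := pow_le_pow_left₀ (nrm_nonneg _) h1 2
    -- Orthogonality of `w` to `H` removes the cross term, leaving Pythagoras. The excess `‖x‖₂²`
    -- gives uniqueness of the nearest point.
    rw [hτ.nrm_sub_sq hw (hsa x hx), ip, h.orthogonal x hx, Complex.zero_re] at h2
    linarith
  refine ⟨⟨⟨_, H.smul_mem 2 h.mem, rfl⟩, ?_⟩, ?_⟩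
  · rintro _ ⟨q, hq, rfl⟩
    obtain ⟨x, -, -, h1⟩ := key q hq
    rw [hd]
    refine (sq_le_sq₀ (nrm_nonneg _) (geodesicDist_nonneg _ _)).1 ?_
    nlinarith [sq_nonneg (nrm τ x)]
  · rintro _ ⟨⟨q, hq, rfl⟩, hmin⟩
    obtain ⟨x, hx, hqx, h1⟩ := key q hq
    have h2 := hmin _ ⟨_, H.smul_mem 2 h.mem, rfl⟩
    rw [hd] at h2
    have h3 := pow_le_pow_left₀ (geodesicDist_nonneg _ _) h2 2
    have h4 : nrm τ x = 0 := pow_eq_zero_iff two_ne_zero |>.1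
      (le_antisymm (by linarith) (sq_nonneg _))
    rw [hqx, hτ.eq_zero_of_nrm_eq_zero h4, exp_zero, mul_one, exp_two_smul]

/-- Each factorization produces a nearest point and each identifies all nearest points, so `e^{2y'}
= e^{2y}`; injectivity of `exp` on selfadjoint elements does the rest. -/
lemma isFactorization_unique (hclosed : IsClosed (H : Set 𝒜))
    (hsupp : HasOrthogonalSupplement τ H) (hbracket : ∀ x ∈ H, ∀ y ∈ H, ⁅x, ⁅x, y⁆⁆ ∈ H)
    {z y w y' w' : 𝒜} (h : IsFactorization τ H z y w) (h' : IsFactorization τ H z y' w') :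
    y' = y ∧ w' = w := by
  have h1 := (hτ.nearest_of_isFactorization hsa hclosed hsupp hbracket h).2 _
    (hτ.nearest_of_isFactorization hsa hclosed hsupp hbracket h').1
  have h2 := exp_injOn (isSelfAdjoint_smul (hsa _ h'.mem) 2)
    (isSelfAdjoint_smul (hsa _ h.mem) 2) h1
  have h3 : y' = y := smul_right_injective 𝒜 (two_ne_zero' ℝ) h2
  subst h3
  exact ⟨rfl, exp_injOn h'.selfAdjoint h.selfAdjoint
    (exp_congr_injective (h'.exp_eq.symm.trans h.exp_eq))⟩

end IsFaithfulTrace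

end Factorization
end FiniteVN

namespace FiniteVN

open NormedSpace Filter Topology

/-! ### Existence by minimization over a ball of `H` -/

section Existence

universe u

variable {𝒜 : Type u} [CStarAlgebra 𝒜] {τ : 𝒜 →ₗ[ℂ] ℂ}

namespace IsFaithfulTrace

variable (hτ : IsFaithfulTrace τ)
include hτ

/-- The squared distance to `e^z` along the move from `e^{2y}` to `e^y e^x e^y`. -/
lemma nrm_logCongr_sq_le {z y y' x : 𝒜} (hz : IsSelfAdjoint z) (hy : IsSelfAdjoint y)
    (hy' : IsSelfAdjoint y') (hx : IsSelfAdjoint x) {ρ : ℝ} (hyρ : ‖y‖ ≤ ρ)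
    (h : exp ((2 : ℝ) • y') = exp y * exp x * exp y) :
    nrm τ (logCongr z y') ^ 2 ≤ nrm τ (logCongr z y) ^ 2 - 2 * ip τ (logCongr z y) x +
      Real.exp (2 * (‖z‖ + 2 * ρ)) * nrm τ x ^ 2 := by
  rw [hτ.nrm_logCongr_eq hz hy hy' hx h]
  refine (hτ.geodesicDist_sq_le (isSelfAdjoint_logCongr z y) hx).trans ?_
  have h1 := norm_logCongr_le hz hy
  gcongr
  linarith

/-- The distance to `e^z` is upper semicontinuous on balls, for the trace norm. -/
lemma exists_nrm_logCongr_sq_le {z : 𝒜} (hz : IsSelfAdjoint z) (ρ : ℝ) :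
    ∃ D E : ℝ, ∀ y y' : 𝒜, IsSelfAdjoint y → IsSelfAdjoint y' → ‖y‖ ≤ ρ → ‖y'‖ ≤ ρ →
      nrm τ (logCongr z y') ^ 2 ≤ nrm τ (logCongr z y) ^ 2 +
        2 * (nrm τ (logCongr z y) * (D * nrm τ (y - y'))) + E * (D * nrm τ (y - y')) ^ 2 := by
  refine ⟨Real.exp (4 * ρ) * (Real.exp ρ * (Real.exp (2 * ρ) * 2 * Real.exp (2 * ρ)) * Real.exp ρ),
    Real.exp (2 * (‖z‖ + 2 * ρ)), fun y y' hy hy' hyρ hyρ' => ?_⟩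
  have hy2 := isSelfAdjoint_smul hy' 2
  -- This `x` satisfies `e^{2y'} = e^y e^x e^y`. On the ball `‖x‖₂` is at most a constant times `‖y
  -- - y'‖₂`, through `e^x - 1`.
  set x := logCongr ((2 : ℝ) • y') y with hxdef
  have hx : IsSelfAdjoint x := isSelfAdjoint_logCongr _ _
  have hn2 : ∀ u : 𝒜, ‖u‖ ≤ ρ → ‖(2 : ℝ) • u‖ ≤ 2 * ρ := fun u hu => by
    rw [norm_smul]; norm_num; exact hu
  have hxρ : ‖x‖ ≤ 4 * ρ := by
    have h1 := norm_logCongr_le hy2 hy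
    have h2 := hn2 y' hyρ'
    linarith
  have hexp : exp x - 1 =
      exp (-y) * (exp ((2 : ℝ) • y') - exp ((2 : ℝ) • y)) * exp (-y) := by
    rw [exp_logCongr hy2 hy, mul_sub, sub_mul, exp_two_smul y]
    simp only [mul_assoc, exp_neg_mul_exp_mul, exp_mul_exp_neg]
  have hnexp : ∀ (u : 𝒜) (r : ℝ), ‖u‖ ≤ r → ‖exp u‖ ≤ Real.exp r := fun u r hu =>
    (norm_exp_le u).trans (Real.exp_le_exp.2 hu)
  have h3 : nrm τ (exp ((2 : ℝ) • y') - exp ((2 : ℝ) • y)) ≤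
      Real.exp (2 * ρ) * (2 * nrm τ (y - y')) * Real.exp (2 * ρ) := by
    refine (hτ.nrm_exp_sub_exp_le _ _).trans ?_
    rw [← smul_sub, hτ.nrm_smul, nrm_sub_comm, abs_two]
    have := nrm_nonneg (τ := τ) (y - y')
    have := hn2 y hyρ
    have := hn2 y' hyρ'
    gcongr
  have h4 : nrm τ (exp x - 1) ≤
      Real.exp ρ * (Real.exp (2 * ρ) * (2 * nrm τ (y - y')) * Real.exp (2 * ρ)) * Real.exp ρ := by
    rw [hexp]
    refine (hτ.nrm_mul_mul_le _ _ _).trans ?_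
    have h5 := hnexp (-y) ρ (by rwa [norm_neg])
    have := nrm_nonneg (τ := τ) (y - y')
    have := nrm_nonneg (τ := τ) (exp ((2 : ℝ) • y') - exp ((2 : ℝ) • y))
    gcongr
  have h5 : nrm τ x ≤ Real.exp (4 * ρ) *
      (Real.exp ρ * (Real.exp (2 * ρ) * 2 * Real.exp (2 * ρ)) * Real.exp ρ) * nrm τ (y - y') := by
    refine (hτ.nrm_le_nrm_exp_sub_one hx).trans ?_
    calc Real.exp ‖x‖ * nrm τ (exp x - 1) ≤ Real.exp (4 * ρ) *
          (Real.exp ρ * (Real.exp (2 * ρ) * (2 * nrm τ (y - y')) * Real.exp (2 * ρ)) *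
            Real.exp ρ) :=
          mul_le_mul (Real.exp_le_exp.2 hxρ) h4 (nrm_nonneg _) (Real.exp_pos _).le
      _ = _ := by ring
  have h6 := hτ.nrm_logCongr_sq_le hz hy hy' hx hyρ (exp_eq_congr_logCongr hy2 hy)
  have h7 := (neg_le_abs _).trans (hτ.abs_ip_le (logCongr z y) x)
  have h8 := mul_le_mul_of_nonneg_left h5 (nrm_nonneg (τ := τ) (logCongr z y))
  have h9 := mul_le_mul_of_nonneg_left (pow_le_pow_left₀ (nrm_nonneg _) h5 2)
    (Real.exp_pos (2 * (‖z‖ + 2 * ρ))).le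
  linarith

variable {H : Submodule ℝ 𝒜} (hsa : ∀ x ∈ H, IsSelfAdjoint x)
  (hclosed : IsClosed (H : Set 𝒜)) (hsupp : HasOrthogonalSupplement τ H)
  (hbracket : ∀ x ∈ H, ∀ y ∈ H, ⁅x, ⁅x, y⁆⁆ ∈ H)

section Projection

variable {P : 𝒜 →L[ℝ] 𝒜} (hPH : ∀ x, P x ∈ H)
  (hP : ∀ x, IsSelfAdjoint x → ∀ h ∈ H, τ (h * (x - P x)) = 0)

include hP in
lemma ip_eq_ip_proj {w h : 𝒜} (hw : IsSelfAdjoint w) (hh : h ∈ H) :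
    ip τ w h = ip τ (P w) h := by
  have h1 : ip τ (w - P w) h = 0 := by rw [hτ.ip_comm, ip, hP w hw h hh, Complex.zero_re]
  rw [ip_sub_left] at h1
  linarith

include hsa hclosed hsupp hbracket hP

include hPH in
/-- A gradient step decreases the distance to `e^z` and stays in the ball. -/
lemma exists_descent (hPid : ∀ x ∈ H, P x = x) {z y : 𝒜} {ρ s : ℝ} (hz : IsSelfAdjoint z)
    (hρ : ‖P‖ * ‖z‖ ≤ 2 * ρ - 1) (hs : 0 ≤ s) (hs1 : s * (4 * ρ + 1) ^ 2 ≤ 1)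
    (hs2 : s * Real.exp (2 * (‖z‖ + 2 * ρ)) ≤ 1) (hy : y ∈ H) (hyρ : ‖y‖ ≤ ρ) :
    ∃ y' ∈ H, ‖y'‖ ≤ ρ ∧ nrm τ (logCongr z y') ^ 2 ≤
      nrm τ (logCongr z y) ^ 2 - s * nrm τ (P (logCongr z y)) ^ 2 := by
  have hysa := hsa y hy
  set w := logCongr z y with hw
  have hwsa : IsSelfAdjoint w := isSelfAdjoint_logCongr z y
  -- This rewrites the step direction as `b - 2y`, where `b = P (w + 2y)` is bounded independently
  -- of `y`, as `norm_log_step_le` requires.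
  have hb : P (w + (2 : ℝ) • y) - (2 : ℝ) • y = P w := by
    rw [map_add, hPid _ (H.smul_mem 2 hy), add_sub_cancel_right]
  have hbρ : ‖P (w + (2 : ℝ) • y)‖ ≤ 2 * ρ - 1 :=
    (P.le_opNorm _).trans ((mul_le_mul_of_nonneg_left
      (norm_log_congr_add_le hwsa hysa hz (exp_logCongr hz hysa)) (norm_nonneg _)).trans hρ)
  have hη := hPH w
  obtain ⟨v, hv, hexp⟩ :=
    hτ.exp_congr_mem hsa hclosed hsupp hbracket (H.smul_mem s hη) hy
  have hvv : (2 : ℝ) • ((1 / 2 : ℝ) • v) = v := by rw [smul_smul]; norm_num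
  have hv' := H.smul_mem (1 / 2 : ℝ) hv
  have hexp' : exp ((2 : ℝ) • ((1 / 2 : ℝ) • v)) = exp y * exp (s • P w) * exp y := by
    rw [hvv, hexp]
  refine ⟨_, hv', ?_, ?_⟩
  · exact norm_log_step_le hysa (hsa _ (hPH _)) (hsa _ hv') hyρ hbρ hs hs1 (by rw [hb, hexp'])
  · have h1 := hτ.nrm_logCongr_sq_le hz hysa (hsa _ hv') (isSelfAdjoint_smul (hsa _ hη) s) hyρ hexp'
    rw [ip_smul_right, hτ.ip_eq_ip_proj hP hwsa hη, ← hτ.nrm_sq_of_isSelfAdjoint (hsa _ hη),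
      hτ.nrm_smul, mul_pow, sq_abs] at h1
    -- The linear gain is `2s‖P w‖₂²`; the choice of `s` keeps the quadratic loss below `s‖P w‖₂²`.
    have h2 := mul_le_mul_of_nonneg_left hs2 (mul_nonneg hs (sq_nonneg (nrm τ (P w))))
    rw [← hw] at h1
    linarith

/-- Two points of almost minimal distance to `e^z`, one of them almost critical, are close. -/
lemma nrm_sub_le_of_almost_minimal {z y y' : 𝒜} (hz : IsSelfAdjoint z) (hy : y ∈ H) (hy' : y' ∈ H)
    {ε : ℝ} (h : nrm τ (logCongr z y') ^ 2 ≤ nrm τ (logCongr z y) ^ 2 + ε ^ 2 / 4)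
    (hη : nrm τ (P (logCongr z y)) ≤ ε / 4) : nrm τ (y' - y) ≤ ε := by
  have hysa := hsa y hy
  have hysa' := hsa y' hy'
  obtain ⟨x, hx, hexp⟩ := hτ.exp_congr_mem hsa hclosed hsupp hbracket
    (H.smul_mem (2 : ℝ) hy') (H.neg_mem hy)
  have hexp' : exp ((2 : ℝ) • y') = exp y * exp x * exp y := by rw [← hexp, exp_congr_neg]
  set w := logCongr z y with hw
  have hwsa : IsSelfAdjoint w := isSelfAdjoint_logCongr z y
  have hε : 0 ≤ ε := by linarith [nrm_nonneg (τ := τ) (P w)]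
  have h1 : nrm τ (w - x) ^ 2 ≤ nrm τ (logCongr z y') ^ 2 := by
    rw [hτ.nrm_logCongr_eq hz hysa hysa' (hsa x hx) hexp']
    exact pow_le_pow_left₀ (nrm_nonneg _) (hτ.nrm_sub_le_geodesicDist hwsa (hsa x hx)) 2
  rw [hτ.nrm_sub_sq hwsa (hsa x hx), hτ.ip_eq_ip_proj hP hwsa hx] at h1
  have h2 := (le_abs_self _).trans (hτ.abs_ip_le (P w) x)
  have h3 := mul_le_mul_of_nonneg_right hη (nrm_nonneg (τ := τ) x)
  -- The estimates combine to `‖x‖₂² ≤ ε²/4 + (ε/2)‖x‖₂`, which fails if `‖x‖₂ > ε`.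
  have h4 : nrm τ x ≤ ε := by
    by_contra! h5
    nlinarith [nrm_nonneg (τ := τ) x]
  have h5 : nrm τ ((2 : ℝ) • y' - (2 : ℝ) • y) ≤ nrm τ x := by
    refine (hτ.nrm_sub_le_geodesicDist (isSelfAdjoint_smul hysa' 2)
      (isSelfAdjoint_smul hysa 2)).trans_eq ?_
    rw [hexp', hτ.geodesicDist_congr_one (hsa x hx) hysa]
  rw [← smul_sub, hτ.nrm_smul, abs_two] at h5
  linarith [nrm_nonneg (τ := τ) (y' - y)]

end Projection

include hsa hclosed hsupp hbracket

/-- If the balls of `𝒜` are complete for the trace norm, then every `e^z` factors. -/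
lemma exists_isFactorization
    (hcomplete : ∀ (ρ : ℝ) (y : ℕ → 𝒜), (∀ n, ‖y n‖ ≤ ρ) →
      (∀ ε > 0, ∃ N, ∀ m ≥ N, ∀ n ≥ N, nrm τ (y n - y m) ≤ ε) →
      ∃ x, ‖x‖ ≤ ρ ∧ Tendsto (fun n => nrm τ (y n - x)) atTop (𝓝 0))
    {z : 𝒜} (hz : IsSelfAdjoint z) : ∃ y w, IsFactorization τ H z y w := by
  obtain ⟨P, hPH, hPid, hP⟩ := exists_projection hclosed hsupp
  -- Chosen so that `2ρ - 1 = ‖P‖ ‖z‖`, the bound on `b` in the descent step.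
  set ρ : ℝ := (‖P‖ * ‖z‖ + 1) / 2 with hρdef
  have hρ0 : 0 < ρ := by positivity
  have hρ : ‖P‖ * ‖z‖ ≤ 2 * ρ - 1 := by rw [hρdef]; linarith
  set s : ℝ := min (1 / (4 * ρ + 1) ^ 2) (1 / Real.exp (2 * (‖z‖ + 2 * ρ))) with hsdef
  have hs0 : 0 < s := lt_min (by positivity) (by positivity)
  have hs1 : s * (4 * ρ + 1) ^ 2 ≤ 1 := (le_div_iff₀ (by positivity)).1 (min_le_left _ _)
  have hs2 : s * Real.exp (2 * (‖z‖ + 2 * ρ)) ≤ 1 :=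
    (le_div_iff₀ (by positivity)).1 (min_le_right _ _)
  set f : 𝒜 → ℝ := fun y => nrm τ (logCongr z y) ^ 2 with hf
  set B : Set 𝒜 := {y | y ∈ H ∧ ‖y‖ ≤ ρ} with hB
  have hstep : ∀ y ∈ B, ∃ y' ∈ B, f y' ≤ f y - s * nrm τ (P (logCongr z y)) ^ 2 := by
    rintro y ⟨hy, hyρ⟩
    obtain ⟨y', hy', hyρ', h⟩ := hτ.exists_descent hsa hclosed hsupp hbracket hPH hP hPid hz hρ
      hs0.le hs1 hs2 hy hyρ
    exact ⟨y', ⟨hy', hyρ'⟩, h⟩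
  have hbdd : BddBelow (f '' B) := ⟨0, by rintro _ ⟨y, -, rfl⟩; exact sq_nonneg _⟩
  have hne : (f '' B).Nonempty := ⟨_, 0, ⟨H.zero_mem, by simpa using hρ0.le⟩, rfl⟩
  set m := sInf (f '' B) with hm
  have hmle : ∀ y ∈ B, m ≤ f y := fun y hy => csInf_le hbdd ⟨y, hy, rfl⟩
  have hseq : ∀ n : ℕ, ∃ y ∈ B, f y < m + 1 / ((n : ℝ) + 1) := fun n => by
    obtain ⟨_, ⟨y, hy, rfl⟩, h⟩ := exists_lt_of_csInf_lt hne
      (lt_add_of_pos_right m (Nat.one_div_pos_of_nat (α := ℝ) (n := n)))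
    exact ⟨y, hy, h⟩
  choose y hyB hyf using hseq
  -- A descent step from `y n` stays in the ball and so cannot go below `m`; hence a near-minimizer
  -- is nearly critical.
  have hη : ∀ n, s * nrm τ (P (logCongr z (y n))) ^ 2 ≤ 1 / ((n : ℝ) + 1) := fun n => by
    obtain ⟨y', hy', h⟩ := hstep _ (hyB n)
    linarith [hmle y' hy', hyf n]
  have hcauchy : ∀ ε > 0, ∃ N, ∀ k ≥ N, ∀ n ≥ N, nrm τ (y n - y k) ≤ ε := by
    intro ε hε
    obtain ⟨N, hN⟩ := exists_nat_one_div_lt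
      (show 0 < min (ε ^ 2 / 4) (s * (ε / 4) ^ 2) by positivity)
    have hle : ∀ k ≥ N, 1 / ((k : ℝ) + 1) < min (ε ^ 2 / 4) (s * (ε / 4) ^ 2) := fun k hk =>
      (Nat.one_div_le_one_div hk).trans_lt hN
    refine ⟨N, fun k hk n hn => ?_⟩
    refine hτ.nrm_sub_le_of_almost_minimal hsa hclosed hsupp hbracket hP hz (hyB k).1
      (hyB n).1 ?_ ?_
    · have h1 := hyf n
      have h2 := hmle _ (hyB k)
      have h3 := (hle n hn).trans_le (min_le_left _ _)
      simp only [hf] at h1 h2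
      linarith
    · have h1 := (hη k).trans ((hle k hk).le.trans (min_le_right _ _))
      exact (sq_le_sq₀ (nrm_nonneg _) (by positivity)).1 (le_of_mul_le_mul_left h1 hs0)
  obtain ⟨x, hxρ, hlim⟩ := hcomplete ρ y (fun n => (hyB n).2) hcauchy
  have hxH : x ∈ H := hτ.mem_of_tendsto_nrm hsa hPH hP (fun n => (hyB n).1) hlim
  -- Upper semicontinuity for the trace norm is enough, since `m` is already a lower bound on the
  -- ball.
  have hfx : f x ≤ m := by
    obtain ⟨D, E, hDE⟩ := hτ.exists_nrm_logCongr_sq_le hz ρ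
    have h1 : Tendsto (fun n : ℕ => m + 1 / ((n : ℝ) + 1)) atTop (𝓝 (m + 0)) :=
      tendsto_const_nhds.add tendsto_one_div_add_atTop_nhds_zero_nat
    have h2 : Tendsto (fun n => f (y n)) atTop (𝓝 m) :=
      tendsto_of_tendsto_of_tendsto_of_le_of_le tendsto_const_nhds (by simpa using h1)
        (fun n => hmle _ (hyB n)) (fun n => (hyf n).le)
    have h3 : Tendsto (fun n => nrm τ (logCongr z (y n))) atTop (𝓝 (√m)) := by
      refine (h2.sqrt).congr fun n => Real.sqrt_sq (nrm_nonneg _)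
    have h4 := hlim.const_mul D
    have h5 := (h2.add ((h3.mul h4).const_mul 2)).add ((h4.pow 2).const_mul E)
    simp only [mul_zero, add_zero, ne_eq, OfNat.ofNat_ne_zero, not_false_eq_true, zero_pow] at h5
    exact ge_of_tendsto' h5 fun n =>
      hDE _ _ (hsa _ (hyB n).1) (hsa _ hxH) (hyB n).2 hxρ
  -- A descent step at the minimizer cannot gain anything, so the component of `logCongr z x` in `H`
  -- vanishes, even if `x` lies on the boundary of the ball.
  obtain ⟨x', hx', h⟩ := hstep x ⟨hxH, hxρ⟩
  have h0 : s * nrm τ (P (logCongr z x)) ^ 2 ≤ s * 0 := by linarith [hmle x' hx']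
  have hPw : P (logCongr z x) = 0 := hτ.eq_zero_of_nrm_eq_zero
    (pow_eq_zero_iff two_ne_zero |>.1 ((le_of_mul_le_mul_left h0 hs0).antisymm (sq_nonneg _)))
  refine ⟨x, logCongr z x, hxH, isSelfAdjoint_logCongr _ _, fun u hu => ?_,
    exp_eq_congr_logCongr hz (hsa x hxH)⟩
  have h1 := hP _ (isSelfAdjoint_logCongr z x) u hu
  rwa [hPw, sub_zero, hτ.tracial] at h1

end IsFaithfulTrace

end Existence
end FiniteVN

theorem mainTheorem5 {K : Type*} [NormedAddCommGroup K] [InnerProductSpace ℂ K]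
    [CompleteSpace K] (A : VonNeumannAlgebra K) (τ : A.toStarSubalgebra →ₗ[ℂ] ℂ)
    (hτ : FiniteVN.IsFiniteTrace A τ)
    (H : Submodule ℝ A.toStarSubalgebra) (hsa : ∀ x ∈ H, IsSelfAdjoint x)
    (hclosed : IsClosed (H : Set A.toStarSubalgebra))
    (hsupp : FiniteVN.HasOrthogonalSupplement τ H)
    (hbracket : ∀ x ∈ H, ∀ y ∈ H, ⁅x, ⁅x, y⁆⁆ ∈ H)
    (z : A.toStarSubalgebra) (hz : IsSelfAdjoint z) :
    ∃ y w : A.toStarSubalgebra, FiniteVN.IsFactorization τ H z y w ∧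
      (∀ y' w', FiniteVN.IsFactorization τ H z y' w' → y' = y ∧ w' = w) ∧
      FiniteVN.IsNearestPoint τ (NormedSpace.exp '' (H : Set A.toStarSubalgebra))
        (NormedSpace.exp z) (NormedSpace.exp ((2 : ℝ) • y)) ∧
      ∀ p, FiniteVN.IsNearestPoint τ (NormedSpace.exp '' (H : Set A.toStarSubalgebra))
        (NormedSpace.exp z) p → p = NormedSpace.exp ((2 : ℝ) • y) := by
  have hτ' := hτ.isFaithfulTrace
  obtain ⟨y, w, h⟩ := hτ'.exists_isFactorization hsa hclosed hsupp hbracket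
    (fun ρ y hρ hy => hτ.exists_limit hρ hy) hz
  exact ⟨y, w, h, fun y' w' h' => hτ'.isFactorization_unique hsa hclosed hsupp hbracket h h',
    hτ'.nearest_of_isFactorization hsa hclosed hsupp hbracket h⟩
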